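/- Conventions. All trees are simplicial trees, regarded as metric spaces with every edge of length $1$. For a group $G$, a *$G$-tree* is an infinite tree with an action of $G$ by simplicial automorphisms without inversions (no element interchanges the two ends of an edge). It is *cocompact* if the translates of some compact set cover the tree, and *minimal* if the tree has no proper $G$-invariant subtree (subtrees are nonempty). A *$G$-morphism* of $G$-trees is a $G$-equivariant map that sends vertices to vertices and edges to edges and preserves adjacency; it is *locally surjective* (*locally injective*) if for each vertex of the domain the induced map from the star (the set of edges at that vertex) to the star of the image vertex is surjective (injective). For a metric space $M$ let $\partial M$ be the set of geodesic rays $\tau:[0,\infty)\to M$ modulo bounded distance. Put $\beta_\tau(p)=\lim_{t\to\infty}(t-d(\tau(t),p))$ and $HB_r(\tau)=\beta_\tau^{-1}([r,\infty))$ for $r\in\mathbb R$. Let $G$ be a finitely generated group with an isometric action $\rho$ on a proper CAT(0) space $M$. Choose a path connected, nonempty CW-complex $X$ of dimension at most $1$ with a free cocompact action of $G$ that permutes the cells, and a continuous $G$-equivariant map $h:X\to M$. Let $X_{(\tau,r)}$ be the largest subcomplex of $X$ contained in $h^{-1}(HB_r(\tau))$. A *lag* is a function $\lambda:\mathbb R\to(0,\infty)$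 with $r-\lambda(r)\to\infty$ as $r\to\infty$. The Bieri–Geoghegan invariant $\Sigma^1(\rho)\subseteq\partial M$ is the set of those $E\in\partial M$, represented by a ray $\tau$, such that for every $r\in\mathbb R$ and $p\in\{-1,0\}$ there is a lag $\lambda$ for which every map $S^p\to X_{(\tau,r)}$ extends to a map $B^{p+1}\to X_{(\tau,r-\lambda(r))}$ (here $S^{-1}=\emptyset$). This does not depend on the choice of $X$, $h$ and $\tau$; to be definite, $E\in\Sigma^1(\rho)$ if the condition holds for some choice of them. **Theorem 1.1.** Let $G$ be a finitely generated group, $T$ a locally finite $G$-tree, and suppose that the action $\rho$ of $G$ on $T$ is cocompact. If there exist a minimal $G$-tree $\tilde T$ (not necessarily locally finite) and a $G$-morphism $q:\tilde T\to T$ that is locally surjective but not locally injective, then $\Sigma^1(\rho)$ contains at most one point of $\partial T$. -/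

import Mathlib

open Filter Topology
open scoped NNReal

universe u v w

/-! ## Boundary, Busemann functions and horoballs of a metric space -/

section Boundary

variable (M : Type v) [MetricSpace M]

/-- A geodesic ray: an isometric embedding of the half line `[0, ∞)`. -/
structure GeodesicRay where
  toFun : ℝ≥0 → M
  isometry : Isometry toFun

variable {M}

instance : CoeFun (GeodesicRay M) (fun _ => ℝ≥0 → M) := ⟨GeodesicRay.toFun⟩

/-- Two geodesic rays are asymptotic if they stay at bounded distance from each other. -/
def GeodesicRay.Asymptotic (τ τ' : GeodesicRay M) : Prop :=
  ∃ K : ℝ, ∀ t : ℝ≥0, dist (τ t) (τ' t) ≤ K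

variable (M) in
/-- The relation of being asymptotic, as a setoid. -/
def GeodesicRay.setoid : Setoid (GeodesicRay M) where
  r := GeodesicRay.Asymptotic
  iseqv :=
    { refl := fun τ => ⟨0, fun t => by simp⟩
      symm := fun ⟨K, hK⟩ => ⟨K, fun t => by rw [dist_comm]; exact hK t⟩
      trans := fun ⟨K, hK⟩ ⟨L, hL⟩ =>
        ⟨K + L, fun t => (dist_triangle _ _ _).trans (add_le_add (hK t) (hL t))⟩ }

variable (M) in
/-- The visual boundary `∂M`: geodesic rays up to being asymptotic. -/
def VisualBoundary : Type v := Quotient (GeodesicRay.setoid M)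

/-- The end point of `∂M` represented by a geodesic ray. -/
def GeodesicRay.endpoint (τ : GeodesicRay M) : VisualBoundary M :=
  Quotient.mk (GeodesicRay.setoid M) τ

/-- The Busemann function `β_τ(p) = lim_{t → ∞} (t - d(τ(t), p))`. -/
noncomputable def busemann (τ : GeodesicRay M) (p : M) : ℝ :=
  limUnder atTop (fun t : ℝ≥0 => (t : ℝ) - dist (τ t) p)

/-- The limit that defines the Busemann function always exists. -/
theorem tendsto_busemann (τ : GeodesicRay M) (p : M) :
    Tendsto (fun t : ℝ≥0 => (t : ℝ) - dist (τ t) p) atTop (𝓝 (busemann τ p)) := by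
  apply tendsto_nhds_limUnder
  refine ⟨_, tendsto_atTop_ciSup ?_ ⟨dist (τ 0) p, ?_⟩⟩
  · intro s t hst
    have h1 : dist (τ t) (τ s) = (t : ℝ) - s := by
      rw [τ.isometry.dist_eq, NNReal.dist_eq, abs_of_nonneg]
      exact sub_nonneg.2 (by exact_mod_cast hst)
    have h2 := dist_triangle (τ t) (τ s) p
    simp only
    linarith
  · rintro _ ⟨t, rfl⟩
    have h1 : dist (τ t) (τ 0) = (t : ℝ) := by
      rw [τ.isometry.dist_eq, NNReal.dist_eq]
      simp
    have h2 := dist_triangle (τ t) p (τ 0)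
    rw [dist_comm p (τ 0)] at h2
    simp only
    linarith

/-- The horoball `HB_r(τ) = β_τ⁻¹([r, ∞))`. -/
def horoball (τ : GeodesicRay M) (r : ℝ) : Set M := {p | r ≤ busemann τ p}

end Boundary

/-! ## Free cocompact `G`-complexes and controlled connectivity -/

/-- The pair `(B^k, S^{k-1})`: every continuous map from the unit sphere of `ℝ^k` into `A`
extends to a continuous map from the closed unit ball of `ℝ^k` into `B`. For `k = 0` the sphere
is empty and the ball is a point. -/
def SpheresExtend {X : Type u} [TopologicalSpace X] (k : ℕ) (A B : Set X) : Prop :=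
  ∀ f : C(Metric.sphere (0 : EuclideanSpace ℝ (Fin k)) 1, X), (∀ x, f x ∈ A) →
    ∃ F : C(Metric.closedBall (0 : EuclideanSpace ℝ (Fin k)) 1, X), (∀ x, F x ∈ B) ∧
      ∀ x (hx : x ∈ Metric.sphere (0 : EuclideanSpace ℝ (Fin k)) 1),
        F ⟨x, Metric.sphere_subset_closedBall hx⟩ = f ⟨x, hx⟩

/-- An `(n-1)`-connected CW-complex of dimension at most `n`, with an action of the group `G` that
is free, cocompact, and permutes the cells. -/
structure FreeCocompactComplex (G : Type u) [Group G] (n : ℕ) where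
  X : Type u
  [top : TopologicalSpace X]
  [t2 : T2Space X]
  [cw : Topology.CWComplex (Set.univ : Set X)]
  dim_le : ∀ m, n < m → IsEmpty (Topology.RelCWComplex.cell (Set.univ : Set X) m)
  connected : ∀ k ≤ n, SpheresExtend k (Set.univ : Set X) Set.univ
  action : G →* (X ≃ₜ X)
  free : ∀ g x, action g x = x → g = 1
  cocompact : ∃ K : Set X, IsCompact K ∧ ∀ x, ∃ g, ∃ y ∈ K, action g y = x
  permutes : ∀ g m (e : Topology.RelCWComplex.cell (Set.univ : Set X) m),
    ∃ e' : Topology.RelCWComplex.cell (Set.univ : Set X) m,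
      action g '' Topology.RelCWComplex.openCell m e = Topology.RelCWComplex.openCell m e'

attribute [instance] FreeCocompactComplex.top FreeCocompactComplex.t2 FreeCocompactComplex.cw

section Sigma

variable {G : Type u} [Group G] {M : Type v} [MetricSpace M]

/-- A control map for an isometric action `ρ`: a continuous `G`-map to `M`. -/
structure ControlMap {n : ℕ} (P : FreeCocompactComplex G n) (ρ : G →* (M ≃ᵢ M)) where
  toFun : C(P.X, M)
  equivariant : ∀ g x, toFun (P.action g x) = ρ g (toFun x)

/-- `X_{(τ, r)}`: the largest subcomplex of `X` contained in the preimage of the horoball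
`HB_r(τ)`, that is, the union of all subcomplexes contained in this preimage. -/
def ControlMap.over {n : ℕ} {P : FreeCocompactComplex G n} {ρ : G →* (M ≃ᵢ M)}
    (h : ControlMap P ρ) (τ : GeodesicRay M) (r : ℝ) : Set P.X :=
  ⋃ S : {S : Topology.RelCWComplex.Subcomplex (Set.univ : Set P.X) //
      (S : Set P.X) ⊆ h.toFun ⁻¹' horoball τ r}, (S.1 : Set P.X)

/-- A lag function: `l(r) > 0` and `r - l(r) → ∞` as `r → ∞`. -/
def IsLag (l : ℝ → ℝ) : Prop :=
  (∀ r, 0 < l r) ∧ Tendsto (fun r => r - l r) atTop atTop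

/-- The condition of controlled `(n-1)`-connectedness for a control map and a geodesic ray.
The index `k` stands for `p + 1`, where `-1 ≤ p ≤ n - 1`. -/
def ControlMap.Controlled {n : ℕ} {P : FreeCocompactComplex G n} {ρ : G →* (M ≃ᵢ M)}
    (h : ControlMap P ρ) (τ : GeodesicRay M) : Prop :=
  ∀ r : ℝ, ∀ k ≤ n, ∃ l : ℝ → ℝ, IsLag l ∧
    SpheresExtend k (h.over τ r) (h.over τ (r - l r))

/-- `ρ` is controlled `(n-1)`-connected over `E ∈ ∂M`, for some choice of the complex, the control
map and the ray that represents `E`. (For proper CAT(0) spaces the choice is known not to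
matter.) -/
def ControlledConnected (n : ℕ) (ρ : G →* (M ≃ᵢ M)) (E : VisualBoundary M) : Prop :=
  ∃ (P : FreeCocompactComplex G n) (h : ControlMap P ρ) (τ : GeodesicRay M),
    τ.endpoint = E ∧ h.Controlled τ

/-- The Bieri-Geoghegan invariant `Σⁿ(ρ) ⊆ ∂M`. -/
def bieriGeoghegan (n : ℕ) (ρ : G →* (M ≃ᵢ M)) : Set (VisualBoundary M) :=
  {E | ControlledConnected n ρ E}

/-- An isometric action is cocompact if the translates of some compact set cover the space. -/
def IsCocompactAction (ρ : G →* (M ≃ᵢ M)) : Prop :=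
  ∃ K : Set M, IsCompact K ∧ ∀ x, ∃ g, ∃ y ∈ K, ρ g y = x

end Sigma

/-! ## The geometric realization of a simplicial tree -/

section Realization

variable {V : Type v} {T : SimpleGraph V}

/-- The geometric realization of a simplicial tree in barycentric coordinates: formal convex
combinations of vertices whose support is a vertex or an edge. -/
@[ext]
structure TreeRealization (hT : T.IsTree) : Type v where
  coord : V →₀ ℝ
  nonneg : ∀ v, 0 ≤ coord v
  sum_eq_one : ∑ v ∈ coord.support, coord v = 1
  isClique : T.IsClique (coord.support : Set V)

namespace TreeRealization

variable {hT : T.IsTree}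

/-- The distance from a point `x = ∑ x_v v` of the tree to the vertex `w`. As `x` lies on an edge,
and the distance to `w` is an affine function on each edge, it is `∑ x_v d(v, w)`. -/
noncomputable def distVertex (x : TreeRealization hT) (w : V) : ℝ :=
  x.coord.sum fun v a => a * (T.dist v w : ℝ)

theorem distVertex_eq (x : TreeRealization hT) (w : V) :
    x.distVertex w = ∑ v ∈ x.coord.support, x.coord v * (T.dist v w : ℝ) := rfl

theorem abs_distVertex_sub_le (x : TreeRealization hT) (u w : V) :
    |x.distVertex w - T.dist u w| ≤ x.distVertex u := by
  have h : x.distVertex w - T.dist u w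
      = ∑ v ∈ x.coord.support, x.coord v * ((T.dist v w : ℝ) - T.dist u w) := by
    simp only [mul_sub, Finset.sum_sub_distrib, ← Finset.sum_mul, sum_eq_one, one_mul,
      distVertex_eq]
  rw [h, distVertex_eq]
  refine (Finset.abs_sum_le_sum_abs _ _).trans (Finset.sum_le_sum fun v _ => ?_)
  rw [abs_mul, abs_of_nonneg (x.nonneg v)]
  refine mul_le_mul_of_nonneg_left ?_ (x.nonneg v)
  have h1 : (T.dist v w : ℝ) ≤ T.dist v u + T.dist u w := by
    exact_mod_cast hT.connected.dist_triangle
  have h2 : (T.dist u w : ℝ) ≤ T.dist u v + T.dist v w := by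
    exact_mod_cast hT.connected.dist_triangle
  rw [T.dist_comm (u := u) (v := v)] at h2
  rw [abs_le]
  constructor <;> linarith

theorem bddAbove_dist (x y : TreeRealization hT) :
    BddAbove (Set.range fun w => |x.distVertex w - y.distVertex w|) := by
  obtain ⟨u⟩ := hT.connected.nonempty
  refine ⟨x.distVertex u + y.distVertex u, ?_⟩
  rintro _ ⟨w, rfl⟩
  have h1 := abs_le.1 (x.abs_distVertex_sub_le u w)
  have h2 := abs_le.1 (y.abs_distVertex_sub_le u w)
  exact abs_le.2 ⟨by linarith, by linarith⟩

theorem distVertex_self_of_mem (x : TreeRealization hT) {u : V} (hu : u ∈ x.coord.support) :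
    x.distVertex u = 1 - x.coord u := by
  classical
  have h1 := x.sum_eq_one
  rw [← Finset.sum_erase_add _ _ hu] at h1
  rw [distVertex_eq, ← Finset.sum_erase_add _ _ hu, ← eq_sub_of_add_eq h1]
  simp only [SimpleGraph.dist_self, Nat.cast_zero, mul_zero, add_zero]
  refine Finset.sum_congr rfl fun v hv => ?_
  have hv' := Finset.mem_erase.1 hv
  have : T.Adj v u := x.isClique hv'.2 hu hv'.1
  rw [SimpleGraph.dist_eq_one_iff_adj.2 this]
  simp

theorem distVertex_ge (x : TreeRealization hT) (u : V) : 1 - x.coord u ≤ x.distVertex u := by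
  classical
  have h : ∑ v ∈ x.coord.support, x.coord v * (if v = u then (0 : ℝ) else 1) = 1 - x.coord u := by
    have h1 : ∀ v, x.coord v * (if v = u then (0 : ℝ) else 1) = x.coord v - (if v = u then x.coord v else 0) := by
      intro v; split_ifs <;> simp
    simp only [h1, Finset.sum_sub_distrib, x.sum_eq_one, Finset.sum_ite_eq']
    split_ifs with hu
    · rfl
    · rw [Finsupp.notMem_support_iff.1 hu]
  rw [← h, distVertex_eq]
  refine Finset.sum_le_sum fun v _ => mul_le_mul_of_nonneg_left ?_ (x.nonneg v)
  split_ifs with hv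
  · positivity
  · exact_mod_cast hT.connected.pos_dist_of_ne hv

theorem eq_of_distVertex_eq (x y : TreeRealization hT)
    (h : ∀ w, x.distVertex w = y.distVertex w) : x = y := by
  -- on its support, each of the two points has coordinates at most those of the other
  have key : ∀ a b : TreeRealization hT, (∀ w, a.distVertex w = b.distVertex w) →
      ∀ u, a.coord u ≤ b.coord u := by
    intro a b hab u
    by_cases hu : u ∈ a.coord.support
    · have h1 := a.distVertex_self_of_mem hu
      have h2 := b.distVertex_ge u
      rw [hab] at h1
      linarith
    · rw [Finsupp.notMem_support_iff.1 hu]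
      exact b.nonneg u
  ext u
  exact le_antisymm (key x y h u) (key y x (fun w => (h w).symm) u)

/-- The path metric with edges of length `1`. The distance of `x` and `y` is written as
`sup_w |d(x, w) - d(y, w)|` over the vertices `w`: each term is at most the length of the segment
from `x` to `y`, with equality at the vertex `w` in which the edge that contains `y` ends, in the
direction away from `x`. -/
noncomputable instance : MetricSpace (TreeRealization hT) where
  dist x y := ⨆ w, |x.distVertex w - y.distVertex w|
  dist_self x := by
    have : Nonempty V := hT.connected.nonempty
    simp
  dist_comm x y := by simp only [abs_sub_comm]
  dist_triangle x y z := by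
    have : Nonempty V := hT.connected.nonempty
    refine ciSup_le fun w => ?_
    exact (abs_sub_le _ (y.distVertex w) _).trans
      (add_le_add (le_ciSup (bddAbove_dist x y) w) (le_ciSup (bddAbove_dist y z) w))
  eq_of_dist_eq_zero {x y} h := by
    refine eq_of_distVertex_eq x y fun w => ?_
    have h1 : |x.distVertex w - y.distVertex w| ≤ 0 := by
      rw [← h]; exact le_ciSup (bddAbove_dist x y) w
    exact sub_eq_zero.1 (abs_nonpos_iff.1 h1)

theorem dist_def (x y : TreeRealization hT) :
    dist x y = ⨆ w, |x.distVertex w - y.distVertex w| := rfl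

variable (hT) in
/-- A vertex of the tree, as a point of the realization. -/
noncomputable def vertex (v : V) : TreeRealization hT where
  coord := Finsupp.single v 1
  nonneg u := by
    classical
    rw [Finsupp.single_apply]
    split_ifs <;> norm_num
  sum_eq_one := by simp
  isClique := by simp

theorem distVertex_vertex (u w : V) : (vertex hT u).distVertex w = T.dist u w := by
  simp [distVertex, vertex]

theorem dist_vertex (x : TreeRealization hT) (u : V) :
    dist x (vertex hT u) = x.distVertex u := by
  have : Nonempty V := ⟨u⟩
  refine le_antisymm (ciSup_le fun w => ?_) ?_
  · rw [distVertex_vertex]; exact x.abs_distVertex_sub_le u w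
  · refine le_trans ?_ (le_ciSup (bddAbove_dist x (vertex hT u)) u)
    rw [distVertex_vertex]
    simpa using le_abs_self _

/-- On the vertices, the metric is the combinatorial distance. -/
theorem dist_vertex_vertex (u v : V) : dist (vertex hT u) (vertex hT v) = T.dist u v := by
  rw [dist_vertex, distVertex_vertex]

/-- On each edge, the metric is that of the unit interval. -/
theorem dist_of_support_subset_edge (x y : TreeRealization hT) {u v : V}
    (hx : ∀ w, w ≠ u → w ≠ v → x.coord w = 0) (hy : ∀ w, w ≠ u → w ≠ v → y.coord w = 0)
    (huv : T.Adj u v) : dist x y = |x.coord u - y.coord u| := by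
  classical
  have form : ∀ z : TreeRealization hT, (∀ w, w ≠ u → w ≠ v → z.coord w = 0) → ∀ w,
      z.distVertex w = z.coord u * (T.dist u w : ℝ) + (1 - z.coord u) * (T.dist v w : ℝ) := by
    intro z hz w
    have hs : z.coord.support ⊆ {u, v} := by
      intro a ha
      by_contra hne
      simp only [Finset.mem_insert, Finset.mem_singleton, not_or] at hne
      exact Finsupp.mem_support_iff.1 ha (hz a hne.1 hne.2)
    have h1 : z.coord u + z.coord v = 1 := by
      rw [← z.sum_eq_one, Finset.sum_subset hs fun a _ ha => Finsupp.notMem_support_iff.1 ha,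
        Finset.sum_pair huv.ne]
    rw [distVertex_eq, Finset.sum_subset hs fun a _ ha => by
        rw [Finsupp.notMem_support_iff.1 ha, zero_mul], Finset.sum_pair huv.ne, ← h1]
    ring
  have hd : ∀ w, x.distVertex w - y.distVertex w
      = (x.coord u - y.coord u) * ((T.dist u w : ℝ) - T.dist v w) := by
    intro w
    rw [form x hx, form y hy]
    ring
  have h1 : T.dist u v = 1 := SimpleGraph.dist_eq_one_iff_adj.2 huv
  have : Nonempty V := ⟨u⟩
  refine le_antisymm (ciSup_le fun w => ?_) (le_trans ?_ (le_ciSup (bddAbove_dist x y) v))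
  · rw [hd, abs_mul]
    refine mul_le_of_le_one_right (abs_nonneg _) ?_
    have h2 : T.dist u w ≤ T.dist u v + T.dist v w := hT.connected.dist_triangle
    have h3 : T.dist v w ≤ T.dist v u + T.dist u w := hT.connected.dist_triangle
    rw [T.dist_comm (u := v) (v := u), h1] at h3
    rw [h1] at h2
    have h2' : (T.dist u w : ℝ) ≤ 1 + T.dist v w := by exact_mod_cast h2
    have h3' : (T.dist v w : ℝ) ≤ 1 + T.dist u w := by exact_mod_cast h3
    exact abs_le.2 ⟨by linarith, by linarith⟩
  · rw [hd, h1]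
    simp

theorem _root_.SimpleGraph.dist_iso_apply (σ : T ≃g T) (u v : V) :
    T.dist (σ u) (σ v) = T.dist u v := by
  have key : ∀ (τ : T ≃g T) (a b : V), T.Reachable a b → T.dist (τ a) (τ b) ≤ T.dist a b := by
    intro τ a b h
    obtain ⟨p, hp⟩ := h.exists_walk_length_eq_dist
    rw [← hp, ← SimpleGraph.Walk.length_map τ.toHom p]
    exact SimpleGraph.dist_le _
  by_cases h : T.Reachable u v
  · refine le_antisymm (key σ u v h) ?_
    have := key σ.symm (σ u) (σ v) (h.map σ.toHom)
    simpa using this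
  · rw [SimpleGraph.dist_eq_zero_of_not_reachable h, SimpleGraph.dist_eq_zero_of_not_reachable]
    intro h'
    apply h
    simpa using h'.map σ.symm.toHom

/-- The map on the realization that is induced by an automorphism of the tree: it moves the
vertices by the automorphism and is affine on edges. -/
noncomputable def mapAut (σ : T ≃g T) (x : TreeRealization hT) : TreeRealization hT where
  coord := x.coord.equivMapDomain σ.toEquiv
  nonneg v := x.nonneg _
  sum_eq_one := (Finsupp.sum_equivMapDomain σ.toEquiv x.coord fun _ a => a).trans x.sum_eq_one
  isClique := by
    intro a ha b hb hab
    have ha' : σ.symm a ∈ x.coord.support :=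
      Finsupp.mem_support_iff.2
        ((Finsupp.mem_support_iff (f := x.coord.equivMapDomain σ.toEquiv)).1 ha)
    have hb' : σ.symm b ∈ x.coord.support :=
      Finsupp.mem_support_iff.2
        ((Finsupp.mem_support_iff (f := x.coord.equivMapDomain σ.toEquiv)).1 hb)
    have := x.isClique ha' hb' (fun h => hab (σ.symm.injective h))
    exact σ.symm.map_rel_iff.1 this

theorem mapAut_apply (σ : T ≃g T) (x : TreeRealization hT) (v : V) :
    (mapAut σ x).coord v = x.coord (σ.symm v) := rfl

theorem distVertex_mapAut (σ : T ≃g T) (x : TreeRealization hT) (w : V) :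
    (mapAut σ x).distVertex (σ w) = x.distVertex w := by
  have h := Finsupp.sum_equivMapDomain σ.toEquiv x.coord fun v a => a * (T.dist v (σ w) : ℝ)
  refine h.trans (Finset.sum_congr rfl fun v _ => ?_)
  have h1 : T.dist (σ v) (σ w) = T.dist v w := SimpleGraph.dist_iso_apply σ v w
  exact congrArg (fun d : ℕ => x.coord v * (d : ℝ)) h1

theorem isometry_mapAut (σ : T ≃g T) : Isometry (mapAut (hT := hT) σ) := by
  refine Isometry.of_dist_eq fun x y => ?_
  rw [dist_def, dist_def, ← σ.toEquiv.surjective.iSup_comp]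
  refine iSup_congr fun w => ?_
  have hx := distVertex_mapAut σ x w
  have hy := distVertex_mapAut σ y w
  change |(mapAut σ x).distVertex (σ w) - (mapAut σ y).distVertex (σ w)| = _
  rw [hx, hy]

variable (hT) in
/-- The isometric action on the realization that is induced by an action on the tree by simplicial
automorphisms. -/
noncomputable def isometryAction {G : Type u} [Group G] (ρ : G →* (T ≃g T)) :
    G →* (TreeRealization hT ≃ᵢ TreeRealization hT) where
  toFun g :=
    { toFun := mapAut (ρ g)
      invFun := mapAut (ρ g)⁻¹
      left_inv := fun x => TreeRealization.ext (Finsupp.ext fun v => by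
        simp only [mapAut_apply]
        exact congrArg x.coord ((ρ g).symm_apply_apply v))
      right_inv := fun x => TreeRealization.ext (Finsupp.ext fun v => by
        simp only [mapAut_apply]
        exact congrArg x.coord ((ρ g).apply_symm_apply v))
      isometry_toFun := isometry_mapAut _ }
  map_one' := by
    refine IsometryEquiv.ext fun x => TreeRealization.ext (Finsupp.ext fun v => ?_)
    change (mapAut (ρ 1) x).coord v = x.coord v
    rw [map_one, mapAut_apply]
    rfl
  map_mul' g h := by
    refine IsometryEquiv.ext fun x => TreeRealization.ext (Finsupp.ext fun v => ?_)
    change (mapAut (ρ (g * h)) x).coord v = (mapAut (ρ g) (mapAut (ρ h) x)).coord v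
    rw [map_mul]
    rfl

end TreeRealization

end Realization

/-! ## `G`-trees and their morphisms -/

section Trees

variable {G : Type u} [Group G] {V : Type v} {W : Type w} {T : SimpleGraph V} {T' : SimpleGraph W}

/-- A `G`-tree: an infinite simplicial tree with an action by simplicial automorphisms and without
inversions. -/
structure IsGTree (ρ : G →* (T ≃g T)) : Prop where
  isTree : T.IsTree
  infinite : Infinite V
  no_inversion : ∀ g u v, T.Adj u v → ρ g u = v → ρ g v ≠ u

/-- Minimality: there is no proper invariant subtree (nonempty connected subgraph). -/
def IsMinimalAction (ρ : G →* (T ≃g T)) : Prop :=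
  ∀ H : T.Subgraph, H.Connected → (∀ g v, v ∈ H.verts → ρ g v ∈ H.verts) →
    (∀ g u v, H.Adj u v → H.Adj (ρ g u) (ρ g v)) → H = ⊤

/-- The induced map from the star of each vertex to the star of its image is surjective. Edges at
a vertex are given by their other end. -/
def StarSurjective (q : T' →g T) : Prop :=
  ∀ x y, T.Adj (q x) y → ∃ z, T'.Adj x z ∧ q z = y

/-- The induced map from the star of each vertex to the star of its image is injective. -/
def StarInjective (q : T' →g T) : Prop :=
  ∀ x y z, T'.Adj x y → T'.Adj x z → q y = q z → y = z

end Trees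

/-! Let `b` be the Busemann function of an end E in Σ¹, and call an edge ascending if `b` grows
along it; each vertex `v` of T has a single ascending edge, to `up v`. Suppose that `q` folds two
edges `xy`, `xz` of T̃ onto the ascending edge at `q x`. By local surjectivity the ascending path
from `q x` lifts to T̃ through `y` and through `z`. The two lifts stay on different sides of `x`,
and their images rise without bound. As G is finitely generated and T̃ is minimal, orbits in T̃ are
coarsely dense, so points of X over a fixed horoball shadow the far parts of both lifts. Controlled
connectedness joins these points over a second fixed horoball, and the connection must pass near the
separating vertex `x`. Hence `b (q x)` is bounded below, uniformly over all such folds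
(`ControlMap.Controlled.exists_le_busemann`).

Now take a fold and a ray `c` without backtracking in T that begins with the folded edge.
Cocompactness and local finiteness yield `i < j` and `g` in G carrying the oriented edge of `c` at
position `j` to the one at position `i`. So the ray `g^(k+1) c` has at position `j` the edge that
`g^k c` has at position `i`. Without backtracking, no ascending step follows a descending one. If
`g^k c` ascended at position `i`, then `g^(k+1) c` would ascend all the way through position `j`,
and its vertex at position `i` would be lower by `j - i`. Repetition would give ascending folds at
arbitrarily low vertices, against the bound. So every `g^k c` descends from position `i` on, and `j
- i` ascending steps lead from `g^k (c i)` to `g^(k+1) (c i)`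
(`SimpleGraph.IsHorofunction.iterate_up_eq`). The ascending path from `c i` therefore runs through
all points `g^k (c i)`, which do not depend on E; this determines E. -/

namespace SimpleGraph

/-! ### Distances in trees and the two sides of an edge -/

variable {V : Type*} {T : SimpleGraph V}

/-- The component of `u` after the edge from `u` to `v` is removed. -/
def branch (T : SimpleGraph V) (u v : V) : Set V :=
  {w | (T.deleteEdges {s(u, v)}).Reachable w u}

theorem mem_branch_self (u v : V) : u ∈ T.branch u v := Reachable.refl _

theorem IsAcyclic.notMem_branch (hT : T.IsAcyclic) {u v : V} (huv : T.Adj u v) :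
    v ∉ T.branch u v := fun h =>
  isBridge_iff.1 (isAcyclic_iff_forall_adj_isBridge.1 hT huv) h.symm

theorem mem_branch_iff_of_adj {u v a b : V} (hab : T.Adj a b) (hne : s(a, b) ≠ s(u, v)) :
    a ∈ T.branch u v ↔ b ∈ T.branch u v := by
  have h : (T.deleteEdges {s(u, v)}).Adj a b := by
    rw [deleteEdges_adj]
    exact ⟨hab, hne⟩
  exact ⟨fun ha => h.symm.reachable.trans ha, fun hb => h.reachable.trans hb⟩

theorem IsAcyclic.eq_of_branch_crossing (hT : T.IsAcyclic) {u v a b : V} (huv : T.Adj u v)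
    (hab : T.Adj a b) (ha : a ∈ T.branch u v) (hb : b ∉ T.branch u v) : a = u ∧ b = v := by
  by_contra hne
  have h : s(a, b) = s(u, v) := by
    by_contra h
    exact hb ((mem_branch_iff_of_adj hab h).1 ha)
  rcases Sym2.eq_iff.1 h with h | ⟨rfl, rfl⟩
  · exact hne h
  · exact hT.notMem_branch huv ha

/-- The edge is the only passage between its two sides, so the length of any walk splits at the
first exit from the branch. -/
theorem IsTree.dist_eq_of_branch (hT : T.IsTree) {u v a b : V} (huv : T.Adj u v)
    (ha : a ∈ T.branch u v) (hb : b ∉ T.branch u v) :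
    T.dist a b = T.dist a u + 1 + T.dist v b := by
  apply le_antisymm
  · have h1 : T.dist a b ≤ T.dist a v + T.dist v b := hT.connected.dist_triangle
    have h2 : T.dist a v ≤ T.dist a u + T.dist u v := hT.connected.dist_triangle
    rw [dist_eq_one_iff_adj.2 huv] at h2
    omega
  · have key : ∀ {a b : V} (p : T.Walk a b), a ∈ T.branch u v → b ∉ T.branch u v →
        T.dist a u + 1 + T.dist v b ≤ p.length := by
      intro a b p
      induction p with
      | nil => intro h h'; exact absurd h h'
      | @cons a c b hac p ih =>
        intro ha hb
        rw [Walk.length_cons]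
        by_cases hc : c ∈ T.branch u v
        · have h1 := ih hc hb
          have h2 : T.dist a u ≤ T.dist a c + T.dist c u := hT.connected.dist_triangle
          rw [dist_eq_one_iff_adj.2 hac] at h2
          omega
        · obtain ⟨rfl, rfl⟩ := hT.isAcyclic.eq_of_branch_crossing huv hac ha hc
          have := dist_le p
          rw [dist_self]
          omega
    obtain ⟨p, hp⟩ := (hT.connected a b).exists_walk_length_eq_dist
    rw [← hp]
    exact key p ha hb

theorem IsTree.dist_of_mem_branch (hT : T.IsTree) {u v w : V} (huv : T.Adj u v)
    (hw : w ∈ T.branch u v) : T.dist w v = T.dist w u + 1 := by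
  rw [hT.dist_eq_of_branch huv hw (hT.isAcyclic.notMem_branch huv), dist_self]

theorem IsTree.dist_of_notMem_branch (hT : T.IsTree) {u v w : V} (huv : T.Adj u v)
    (hw : w ∉ T.branch u v) : T.dist w u = T.dist w v + 1 := by
  rw [T.dist_comm, hT.dist_eq_of_branch huv (mem_branch_self u v) hw, dist_self,
    T.dist_comm (u := v)]
  omega

/-- The distance to a vertex is convex at each vertex of a tree. -/
theorem IsTree.two_mul_dist_le (hT : T.IsTree) {x y z : V} (hy : T.Adj x y) (hz : T.Adj x z)
    (hyz : y ≠ z) (w : V) : 2 * T.dist w x ≤ T.dist w y + T.dist w z := by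
  by_cases hw : w ∈ T.branch y x
  · have hz' : z ∉ T.branch y x := by
      intro h
      refine hT.isAcyclic.notMem_branch hy.symm ((mem_branch_iff_of_adj hz ?_).2 h)
      intro h
      rcases Sym2.eq_iff.1 h with ⟨h, _⟩ | ⟨_, h⟩
      · exact hy.ne h
      · exact hyz h.symm
    have h1 := hT.dist_eq_of_branch hy.symm hw hz'
    have h2 := hT.dist_of_mem_branch hy.symm hw
    rw [dist_eq_one_iff_adj.2 hz] at h1
    omega
  · have h1 := hT.dist_of_notMem_branch hy.symm hw
    have h2 : T.dist w x ≤ T.dist w z + T.dist z x := hT.connected.dist_triangle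
    rw [dist_eq_one_iff_adj.2 hz.symm] at h2
    omega

theorem finite_setOf_dist_le (hT : T.Connected) (hfin : ∀ v, (T.neighborSet v).Finite) (v : V)
    (n : ℕ) : {w | T.dist v w ≤ n}.Finite := by
  induction n with
  | zero =>
    refine (Set.finite_singleton v).subset fun w hw => ?_
    exact ((hT v w).dist_eq_zero_iff.1 (Nat.le_zero.1 hw)).symm
  | succ n ih =>
    refine (ih.union (ih.biUnion fun w _ => hfin w)).subset fun w hw => ?_
    by_cases h : T.dist v w ≤ n
    · exact Or.inl h
    · right
      obtain ⟨p, hp⟩ := (hT w v).exists_walk_length_eq_dist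
      cases p with
      | nil => simp at h
      | @cons _ c _ hc p =>
        rw [Walk.length_cons, T.dist_comm] at hp
        have h1 := dist_le p
        rw [T.dist_comm] at h1
        have hw' : T.dist v w ≤ n + 1 := hw
        exact Set.mem_biUnion (x := c) (show T.dist v c ≤ n by omega) hc.symm

theorem exists_adj_dist_add_one (hT : T.Connected) {a x : V} (h : a ≠ x) :
    ∃ y, T.Adj x y ∧ T.dist a x = T.dist a y + 1 := by
  obtain ⟨p, hp⟩ := (hT x a).exists_walk_length_eq_dist
  cases p with
  | nil => exact absurd rfl h
  | @cons _ y _ hy p =>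
    refine ⟨y, hy, ?_⟩
    rw [Walk.length_cons, T.dist_comm] at hp
    have h1 := dist_le p
    have h2 : T.dist a x ≤ T.dist a y + T.dist y x := hT.dist_triangle
    rw [T.dist_comm] at h1
    rw [dist_eq_one_iff_adj.2 hy.symm] at h2
    omega

theorem Hom.dist_le {W : Type*} {T' : SimpleGraph W} (hT' : T'.Connected) (q : T' →g T)
    (x y : W) : T.dist (q x) (q y) ≤ T'.dist x y := by
  obtain ⟨p, hp⟩ := (hT' x y).exists_walk_length_eq_dist
  rw [← hp, ← Walk.length_map q p]
  exact SimpleGraph.dist_le _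

/-! ### Horofunctions on trees and their ascending paths -/

/-- A Busemann function on the vertices of a tree: it changes by one along each edge, and it
increases towards exactly one neighbour `up v` of each vertex `v`. -/
structure IsHorofunction (T : SimpleGraph V) (b : V → ℝ) (up : V → V) : Prop where
  adj_up : ∀ v, T.Adj v (up v)
  apply_up : ∀ v, b (up v) = b v + 1
  eq_up_of_adj : ∀ v w, T.Adj v w → w = up v ∨ v = up w

namespace IsHorofunction

variable {b : V → ℝ} {up : V → V} (hb : T.IsHorofunction b up)
include hb

theorem apply_iterate (n : ℕ) (v : V) : b (up^[n] v) = b v + n := by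
  induction n with
  | zero => simp
  | succ n ih =>
    rw [Function.iterate_succ_apply', hb.apply_up, ih]
    push_cast
    ring

/-- Each edge joins some `v` to `up v`, and its ends are moved to the adjacent vertices `up v` and
`up (up v)`. -/
theorem dist_up_le (hT : T.Connected) (x y : V) : T.dist (up x) (up y) ≤ T.dist x y := by
  have key : ∀ {x y : V} (p : T.Walk x y), T.dist (up x) (up y) ≤ p.length := by
    intro x y p
    induction p with
    | nil => simp
    | @cons x c y hxc p ih =>
      have h1 : T.dist (up x) (up c) ≤ 1 := by
        rcases hb.eq_up_of_adj x c hxc with h | h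
        · rw [← h, dist_eq_one_iff_adj.2 (hb.adj_up c)]
        · rw [← h, dist_eq_one_iff_adj.2 (hb.adj_up x).symm]
      have h2 : T.dist (up x) (up y) ≤ T.dist (up x) (up c) + T.dist (up c) (up y) :=
        hT.dist_triangle
      rw [Walk.length_cons]
      omega
  obtain ⟨p, hp⟩ := (hT x y).exists_walk_length_eq_dist
  rw [← hp]
  exact key p

theorem dist_iterate_le (hT : T.Connected) (n : ℕ) (x y : V) :
    T.dist (up^[n] x) (up^[n] y) ≤ T.dist x y := by
  induction n with
  | zero => simp
  | succ n ih =>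
    rw [Function.iterate_succ_apply', Function.iterate_succ_apply']
    exact (hb.dist_up_le hT _ _).trans ih

theorem dist_self_iterate_le (hT : T.Connected) (n : ℕ) (x : V) : T.dist x (up^[n] x) ≤ n := by
  induction n with
  | zero => simp
  | succ n ih =>
    rw [Function.iterate_succ_apply']
    have h : T.dist x (up (up^[n] x)) ≤ T.dist x (up^[n] x) + T.dist (up^[n] x) (up (up^[n] x)) :=
      hT.dist_triangle
    rw [dist_eq_one_iff_adj.2 (hb.adj_up _)] at h
    omega

theorem dist_iterate_iterate_le (hT : T.Connected) (m n : ℕ) (x : V) :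
    (T.dist (up^[m] x) (up^[n] x) : ℝ) ≤ |(m : ℝ) - n| := by
  rcases le_total m n with h | h
  · obtain ⟨k, rfl⟩ := Nat.exists_eq_add_of_le' h
    rw [Function.iterate_add_apply, abs_sub_comm]
    push_cast
    rw [add_sub_cancel_right, Nat.abs_cast]
    exact_mod_cast hb.dist_self_iterate_le hT k _
  · obtain ⟨k, rfl⟩ := Nat.exists_eq_add_of_le' h
    rw [Function.iterate_add_apply, T.dist_comm]
    push_cast
    rw [add_sub_cancel_right, Nat.abs_cast]
    exact_mod_cast hb.dist_self_iterate_le hT k _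

/-- Along a walk, an ascending step is a step of `up` and costs nothing. A descending step costs at
most 2, because iterates of `up` do not increase distances. Length minus gain in height is exactly
twice the number of descending steps. -/
theorem dist_iterate_dist_le (hT : T.Connected) (a c : V) :
    (T.dist (up^[T.dist a c] a) c : ℝ) ≤ T.dist a c - (b c - b a) := by
  have key : ∀ {a c : V} (p : T.Walk a c),
      (T.dist (up^[p.length] a) c : ℝ) ≤ p.length - (b c - b a) := by
    intro a c p
    induction p with
    | nil => simp
    | @cons a d c had p ih =>
      rw [Walk.length_cons, Function.iterate_succ_apply]
      push_cast
      rcases hb.eq_up_of_adj a d had with h | h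
      · have := hb.apply_up a
        rw [← h] at this ⊢
        linarith
      · have h0 := hb.apply_up d
        rw [← h] at h0
        have h1 : T.dist (up^[p.length] (up a)) c ≤
            T.dist (up^[p.length] (up a)) (up^[p.length] d) + T.dist (up^[p.length] d) c :=
          hT.dist_triangle
        have h2 := hb.dist_iterate_le hT p.length (up a) d
        have h3 : T.dist (up a) d ≤ T.dist (up a) a + T.dist a d := hT.dist_triangle
        rw [dist_eq_one_iff_adj.2 (hb.adj_up a).symm, dist_eq_one_iff_adj.2 had] at h3
        have h4 : (T.dist (up^[p.length] (up a)) c : ℝ) ≤ 2 + T.dist (up^[p.length] d) c := by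
          exact_mod_cast (by omega :
            T.dist (up^[p.length] (up a)) c ≤ 2 + T.dist (up^[p.length] d) c)
        linarith
  obtain ⟨p, hp⟩ := (hT a c).exists_walk_length_eq_dist
  rw [← hp]
  exact key p

/-- Along a path without backtracking, an ascending step is preceded by ascending steps only. -/
theorem up_eq_of_le {c : ℕ → V} (hadj : ∀ n, T.Adj (c n) (c (n + 1)))
    (hc : ∀ n, c (n + 2) ≠ c n) {m n : ℕ} (hmn : m ≤ n) (h : up (c n) = c (n + 1)) :
    up (c m) = c (m + 1) := by
  induction n, hmn using Nat.le_induction with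
  | base => exact h
  | succ n _ ih =>
    apply ih
    -- If the step before descended, the ascending step after it would return along the same edge.
    rcases hb.eq_up_of_adj _ _ (hadj n) with h' | h'
    · exact h'.symm
    · exact absurd (h.symm.trans h'.symm) (hc n)

/-- Consider a sequence of paths without backtracking, each of which runs through an edge that is
farther down on the next one. If the heights at which the paths start in an ascending direction
are bounded below, then the fixed position of this edge ascends along the sequence. -/
theorem iterate_up_eq {c : ℕ → ℕ → V} (hadj : ∀ k n, T.Adj (c k n) (c k (n + 1)))
    (hc : ∀ k n, c k (n + 2) ≠ c k n) {i j : ℕ} (hij : i < j)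
    (h0 : ∀ k, c (k + 1) j = c k i) (h1 : ∀ k, c (k + 1) (j + 1) = c k (i + 1))
    {s : ℝ} (hs : ∀ k, up (c k 0) = c k 1 → s ≤ b (c k 0)) (k : ℕ) :
    up^[k * (j - i)] (c 0 i) = c k i := by
  have up_of_le : ∀ {k m n}, m ≤ n → up (c k n) = c k (n + 1) → up (c k m) = c k (m + 1) :=
    fun {k m n} => hb.up_eq_of_le (hadj k) (hc k)
  have height : ∀ {k n}, up (c k n) = c k (n + 1) → ∀ m ≤ n, b (c k m) = b (c k 0) + m := by
    intro k n h m
    induction m with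
    | zero => simp
    | succ m ih =>
      intro hm
      rw [← up_of_le (by omega) h, hb.apply_up, ih (by omega)]
      push_cast
      ring
  have step : ∀ {k}, up (c k i) = c k (i + 1) → up (c (k + 1) j) = c (k + 1) (j + 1) := by
    intro k h
    rw [h0, h1, h]
  -- An ascending edge at position `i` recurs in all later paths, lower by `j - i ≥ 1` each time;
  -- the starting vertices are no higher, and so violate the bound `s`.
  have not_up : ∀ k, up (c k i) ≠ c k (i + 1) := by
    intro k h
    have descend : ∀ m : ℕ, up (c (k + m) i) = c (k + m) (i + 1) ∧
        b (c (k + m) i) ≤ b (c k i) - m := by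
      intro m
      induction m with
      | zero => simpa using h
      | succ m ih =>
        have h2 := step ih.1
        refine ⟨up_of_le hij.le h2, ?_⟩
        have h3 := height h2 j le_rfl
        have h4 := height h2 i hij.le
        rw [h0] at h3
        have h5 : (i : ℝ) + 1 ≤ j := by exact_mod_cast hij
        have h6 := ih.2
        rw [← add_assoc]
        push_cast
        linarith
    obtain ⟨m, hm⟩ := exists_nat_gt (b (c k i) - s)
    have h2 := hs (k + m) (up_of_le (Nat.zero_le i) (descend m).1)
    have h3 := height (descend m).1 i le_rfl
    have h4 := (descend m).2
    have h5 : (0 : ℝ) ≤ i := by positivity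
    linarith
  -- An ascending step beyond `i` would force one at `i`; so the path descends from there, and `up`
  -- retraces it.
  have down : ∀ k m, up^[m] (c k (i + m)) = c k i := by
    intro k m
    induction m with
    | zero => rfl
    | succ m ih =>
      rw [Function.iterate_succ_apply, ← add_assoc]
      rcases hb.eq_up_of_adj _ _ (hadj k (i + m)) with h' | h'
      · exact absurd (up_of_le (Nat.le_add_right i m) h'.symm) (not_up k)
      · rw [← h', ih]
  induction k with
  | zero => simp
  | succ k ih =>
    rw [add_mul, one_mul, add_comm, Function.iterate_add_apply, ih, ← h0]
    have := down (k + 1) (j - i)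
    rwa [Nat.add_sub_cancel' hij.le] at this

end IsHorofunction

end SimpleGraph

/-! ### Busemann functions of rays in metric spaces -/

section Busemann

variable {M : Type*} [MetricSpace M]

theorem GeodesicRay.dist_eq_abs (τ : GeodesicRay M) (s t : ℝ≥0) :
    dist (τ s) (τ t) = |(s : ℝ) - t| := by
  rw [τ.isometry.dist_eq, NNReal.dist_eq]

theorem tendsto_dist_sub_dist (τ : GeodesicRay M) (p p' : M) :
    Tendsto (fun t : ℝ≥0 => dist (τ t) p - dist (τ t) p') atTop
      (𝓝 (busemann τ p' - busemann τ p)) := by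
  refine ((tendsto_busemann τ p').sub (tendsto_busemann τ p)).congr fun t => ?_
  ring

theorem busemann_sub_le (τ : GeodesicRay M) (p p' : M) :
    busemann τ p' - busemann τ p ≤ dist p p' := by
  refine le_of_tendsto (tendsto_dist_sub_dist τ p p') (Eventually.of_forall fun t => ?_)
  have := dist_triangle (τ t) p' p
  rw [dist_comm p' p] at this
  linarith

theorem busemann_apply (τ : GeodesicRay M) (t : ℝ≥0) : busemann τ (τ t) = t := by
  refine tendsto_nhds_unique (tendsto_busemann τ (τ t)) ?_
  refine tendsto_const_nhds.congr' ?_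
  filter_upwards [eventually_ge_atTop t] with s hs
  have : (t : ℝ) ≤ s := by exact_mod_cast hs
  rw [τ.dist_eq_abs, abs_of_nonneg (by linarith)]
  ring

theorem tendsto_dist_atTop (τ : GeodesicRay M) (p : M) :
    Tendsto (fun t : ℝ≥0 => dist (τ t) p) atTop atTop := by
  have h : Tendsto (fun t : ℝ≥0 => (t : ℝ) - dist (τ 0) p) atTop atTop :=
    tendsto_atTop_add_const_right _ _ (NNReal.tendsto_coe_atTop.2 tendsto_id)
  refine tendsto_atTop_mono (fun t => ?_) h
  have h1 := τ.dist_eq_abs t 0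
  have h2 := dist_triangle (τ t) p (τ 0)
  rw [NNReal.coe_zero, sub_zero, NNReal.abs_eq] at h1
  rw [dist_comm p (τ 0)] at h2
  linarith

end Busemann

/-! ### Geodesic rays in a tree and their horofunctions -/

namespace TreeRealization

variable {V : Type v} {T : SimpleGraph V} {hT : T.IsTree}

theorem support_nonempty (x : TreeRealization hT) : x.coord.support.Nonempty := by
  by_contra h
  have := x.sum_eq_one
  rw [Finset.not_nonempty_iff_eq_empty.1 h, Finset.sum_empty] at this
  exact zero_ne_one this

theorem dist_vertex_le_one (x : TreeRealization hT) {a : V} (ha : a ∈ x.coord.support) :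
    dist x (vertex hT a) ≤ 1 := by
  rw [dist_vertex, distVertex_self_of_mem x ha]
  linarith [x.nonneg a]

/-- At a point off the vertex `u`, the distances to `u` and to a neighbour of `u` differ by as much
as at the ends of the edge that contains the point. -/
theorem distVertex_sub_distVertex (x : TreeRealization hT) {u v a : V} (huv : T.Adj u v)
    (hu : u ∉ x.coord.support) (ha : a ∈ x.coord.support) :
    x.distVertex u - x.distVertex v = (T.dist a u : ℝ) - T.dist a v := by
  have h : ∀ c ∈ x.coord.support, (T.dist c u : ℝ) - T.dist c v = T.dist a u - T.dist a v := by
    intro c hc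
    have hiff : c ∈ T.branch u v ↔ a ∈ T.branch u v := by
      rcases eq_or_ne c a with rfl | hca
      · rfl
      · refine SimpleGraph.mem_branch_iff_of_adj (x.isClique hc ha hca) fun h => ?_
        rcases Sym2.eq_iff.1 h with ⟨rfl, _⟩ | ⟨_, rfl⟩
        · exact hu hc
        · exact hu ha
    by_cases hcu : c ∈ T.branch u v
    · rw [hT.dist_of_mem_branch huv hcu, hT.dist_of_mem_branch huv (hiff.1 hcu)]
      push_cast
      ring
    · rw [hT.dist_of_notMem_branch huv hcu, hT.dist_of_notMem_branch huv (fun h => hcu (hiff.2 h))]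
      push_cast
      ring
  rw [distVertex_eq, distVertex_eq, ← Finset.sum_sub_distrib]
  simp only [← mul_sub]
  rw [Finset.sum_congr rfl fun c hc => by rw [h c hc], ← Finset.sum_mul, x.sum_eq_one, one_mul]

theorem two_mul_distVertex_le (p : TreeRealization hT) {x y z : V} (hy : T.Adj x y)
    (hz : T.Adj x z) (hyz : y ≠ z) :
    2 * p.distVertex x ≤ p.distVertex y + p.distVertex z := by
  rw [distVertex_eq, distVertex_eq, distVertex_eq, Finset.mul_sum, ← Finset.sum_add_distrib]
  refine Finset.sum_le_sum fun w _ => ?_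
  have h : 2 * (T.dist w x : ℝ) ≤ T.dist w y + T.dist w z := by
    exact_mod_cast hT.two_mul_dist_le hy hz hyz w
  have := mul_le_mul_of_nonneg_left h (p.nonneg w)
  linarith

theorem eventually_notMem_support (τ : GeodesicRay (TreeRealization hT)) (u : V) :
    ∀ᶠ t : ℝ≥0 in atTop, u ∉ (τ t).coord.support := by
  filter_upwards [(tendsto_dist_atTop τ (vertex hT u)).eventually_gt_atTop 1] with t ht hu
  exact absurd ht (not_lt.2 (dist_vertex_le_one _ hu))

/-- For large `t` the point `τ t` lies off the open star of `u`, and the difference of its distances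
to `u` and `v` is exactly `1` or `-1`; this persists in the limit. -/
theorem busemann_sub_mem (τ : GeodesicRay (TreeRealization hT)) {u v : V} (huv : T.Adj u v) :
    busemann τ (vertex hT v) - busemann τ (vertex hT u) ∈ ({1, -1} : Set ℝ) := by
  refine (Set.toFinite ({1, -1} : Set ℝ)).isClosed.mem_of_tendsto
    (tendsto_dist_sub_dist τ (vertex hT u) (vertex hT v)) ?_
  filter_upwards [eventually_notMem_support τ u] with t ht
  obtain ⟨a, ha⟩ := (τ t).support_nonempty
  rw [dist_vertex, dist_vertex, distVertex_sub_distVertex _ huv ht ha]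
  by_cases hau : a ∈ T.branch u v
  · rw [hT.dist_of_mem_branch huv hau]
    right
    push_cast
    simp
  · rw [hT.dist_of_notMem_branch huv hau]
    left
    push_cast
    simp

/-- Existence: some neighbour of `x` is nearer to `τ t` by exactly 1, and local finiteness lets one
large `t` serve for all neighbours at once. Uniqueness: by convexity of the distance to `τ t` at
`x`, two neighbours cannot both be nearer, not even in the limit. -/
theorem exists_isHorofunction (hfin : ∀ v : V, (T.neighborSet v).Finite)
    (τ : GeodesicRay (TreeRealization hT)) :
    ∃ up : V → V, T.IsHorofunction (fun v => busemann τ (vertex hT v)) up := by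
  have hex : ∀ x, ∃ y, T.Adj x y ∧ busemann τ (vertex hT y) = busemann τ (vertex hT x) + 1 := by
    intro x
    by_contra! hne
    have h1 : ∀ y ∈ T.neighborSet x, ∀ᶠ t : ℝ≥0 in atTop,
        dist (τ t) (vertex hT x) - dist (τ t) (vertex hT y) < 1 := by
      intro y hy
      refine (tendsto_dist_sub_dist τ (vertex hT x) (vertex hT y)).eventually_lt_const ?_
      rcases busemann_sub_mem τ hy with h | h
      · exact absurd (eq_add_of_sub_eq' h) (hne y hy)
      · rw [Set.mem_singleton_iff.1 h]
        norm_num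
    obtain ⟨t, ht, htx⟩ :=
      (((eventually_all_finite (hfin x)).2 h1).and (eventually_notMem_support τ x)).exists
    obtain ⟨a, ha⟩ := (τ t).support_nonempty
    obtain ⟨y, hy, hay⟩ := SimpleGraph.exists_adj_dist_add_one hT.connected
      (show a ≠ x from fun h => htx (h ▸ ha))
    have h2 := ht y hy
    rw [dist_vertex, dist_vertex, distVertex_sub_distVertex _ hy htx ha, hay] at h2
    push_cast at h2
    linarith
  choose up hup using hex
  refine ⟨up, fun v => (hup v).1, fun v => (hup v).2, fun v w hvw => ?_⟩
  have unique : ∀ x y, T.Adj x y →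
      busemann τ (vertex hT y) = busemann τ (vertex hT x) + 1 → y = up x := by
    intro x y hxy hby
    by_contra hne
    have h1 : ∀ t, 0 ≤ (dist (τ t) (vertex hT y) - dist (τ t) (vertex hT x)) +
        (dist (τ t) (vertex hT (up x)) - dist (τ t) (vertex hT x)) := by
      intro t
      have := two_mul_distVertex_le (τ t) hxy (hup x).1 hne
      simp only [dist_vertex]
      linarith
    have h2 := ge_of_tendsto' ((tendsto_dist_sub_dist τ (vertex hT y) (vertex hT x)).add
      (tendsto_dist_sub_dist τ (vertex hT (up x)) (vertex hT x))) h1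
    rw [hby, (hup x).2] at h2
    linarith
  rcases busemann_sub_mem τ hvw with h | h
  · exact Or.inl (unique v w hvw (eq_add_of_sub_eq' h))
  · refine Or.inr (unique w v hvw.symm ?_)
    rw [Set.mem_singleton_iff] at h
    linarith

/-- The Busemann function grows at full speed along `τ`, so a path along `τ` loses only a bounded
amount against the ascending path. Changing the starting vertex costs at most the initial distance.
-/
theorem exists_dist_iterate_le (τ : GeodesicRay (TreeRealization hT)) {up : V → V}
    (hup : T.IsHorofunction (fun v => busemann τ (vertex hT v)) up) (x : V) :
    ∃ C : ℝ, ∀ t : ℝ≥0, dist (τ t) (vertex hT (up^[⌊t⌋₊] x)) ≤ C := by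
  obtain ⟨a, ha⟩ := (τ 0).support_nonempty
  have ha' := dist_vertex_le_one _ ha
  -- `8 = 1 + 4 + 3`: moving from `τ t` to the vertex `c`, the deviation of `c` from the ascending
  -- path of `a`, and taking `⌊t⌋₊` steps in place of `T.dist a c`.
  refine ⟨8 + T.dist a x, fun t => ?_⟩
  obtain ⟨c, hc⟩ := (τ t).support_nonempty
  have hc' := dist_vertex_le_one _ hc
  have h0 : dist (τ t) (τ 0) = t := by
    rw [τ.dist_eq_abs, NNReal.coe_zero, sub_zero, NNReal.abs_eq]
  have hac : |(T.dist a c : ℝ) - t| ≤ 2 := by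
    rw [← dist_vertex_vertex (hT := hT), ← h0, abs_le]
    have h1 := dist_triangle4 (vertex hT a) (τ 0) (τ t) (vertex hT c)
    have h2 := dist_triangle4 (τ t) (vertex hT c) (vertex hT a) (τ 0)
    rw [dist_comm (vertex hT a) (τ 0), dist_comm (τ 0) (τ t)] at h1
    rw [dist_comm (vertex hT a) (τ 0), dist_comm (vertex hT c) (vertex hT a)] at h2
    constructor <;> linarith
  have hbc : (t : ℝ) - 1 ≤ busemann τ (vertex hT c) := by
    have := busemann_sub_le τ (vertex hT c) (τ t)
    rw [busemann_apply, dist_comm] at this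
    linarith
  have hba : busemann τ (vertex hT a) ≤ 1 := by
    have := busemann_sub_le τ (τ 0) (vertex hT a)
    rw [busemann_apply, NNReal.coe_zero] at this
    linarith
  have h1 := hup.dist_iterate_dist_le hT.connected a c
  have h2 := hup.dist_iterate_iterate_le hT.connected (T.dist a c) ⌊t⌋₊ a
  have h3 : (T.dist (up^[⌊t⌋₊] a) (up^[⌊t⌋₊] x) : ℝ) ≤ T.dist a x := by
    exact_mod_cast hup.dist_iterate_le hT.connected ⌊t⌋₊ a x
  have h4 : |(T.dist a c : ℝ) - ⌊t⌋₊| ≤ 3 := by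
    have h5 : ((⌊t⌋₊ : ℝ≥0) : ℝ) ≤ t := NNReal.coe_le_coe.2 (Nat.floor_le t.2)
    have h6 : (t : ℝ) < ((⌊t⌋₊ : ℝ≥0) : ℝ) + 1 := by exact_mod_cast Nat.lt_floor_add_one t
    rw [NNReal.coe_natCast] at h5 h6
    rw [abs_le] at hac ⊢
    constructor <;> linarith
  rw [← dist_vertex_vertex (hT := hT)] at h1 h2 h3
  have h7 := dist_triangle4 (τ t) (vertex hT c) (vertex hT (up^[T.dist a c] a))
    (vertex hT (up^[⌊t⌋₊] x))
  have h8 := dist_triangle (vertex hT (up^[T.dist a c] a)) (vertex hT (up^[⌊t⌋₊] a))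
    (vertex hT (up^[⌊t⌋₊] x))
  rw [dist_comm (vertex hT c)] at h7
  have h9 := (abs_le.1 hac).2
  linarith

/-- Two rays are asymptotic if the ascending paths from a vertex meet at bounded intervals. -/
theorem asymptotic_of_iterate_eq {τ τ' : GeodesicRay (TreeRealization hT)} {up up' : V → V}
    (hup : T.IsHorofunction (fun v => busemann τ (vertex hT v)) up)
    (hup' : T.IsHorofunction (fun v => busemann τ' (vertex hT v)) up') {x : V} {L : ℕ}
    (hL : 0 < L) (h : ∀ k, up^[k * L] x = up'^[k * L] x) : τ.Asymptotic τ' := by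
  obtain ⟨C, hC⟩ := exists_dist_iterate_le τ hup x
  obtain ⟨C', hC'⟩ := exists_dist_iterate_le τ' hup' x
  refine ⟨C + (L + L) + C', fun t => ?_⟩
  set n := ⌊t⌋₊
  -- The paths agree at multiples of `L`, and `n` is within `L` of one.
  have hn : |(n : ℝ) - (n / L * L : ℕ)| ≤ L := by
    have h1 := Nat.div_add_mod' n L
    have h2 := (Nat.mod_lt n hL).le
    have h3 : (n : ℝ) = (n / L * L : ℕ) + (n % L : ℕ) := by exact_mod_cast h1.symm
    rw [h3, add_sub_cancel_left, Nat.abs_cast]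
    exact_mod_cast h2
  have h1 := (hup.dist_iterate_iterate_le hT.connected n (n / L * L) x).trans hn
  have h2 := (hup'.dist_iterate_iterate_le hT.connected n (n / L * L) x).trans hn
  rw [h, ← dist_vertex_vertex (hT := hT)] at h1
  rw [← dist_vertex_vertex (hT := hT), dist_comm] at h2
  have h3 := dist_triangle4 (τ t) (vertex hT (up^[n] x)) (vertex hT (up'^[n] x)) (τ' t)
  have h4 := dist_triangle (vertex hT (up^[n] x)) (vertex hT (up'^[n / L * L] x))
    (vertex hT (up'^[n] x))
  have h5 := hC t
  have h6 := hC' t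
  rw [dist_comm] at h6
  linarith

theorem isometryAction_vertex {G : Type u} [Group G] (ρ : G →* (T ≃g T)) (g : G) (v : V) :
    isometryAction hT ρ g (vertex hT v) = vertex hT (ρ g v) :=
  TreeRealization.ext (Finsupp.equivMapDomain_single _ _ _)

theorem exists_finite_vertices (hfin : ∀ v : V, (T.neighborSet v).Finite) {G : Type u} [Group G]
    {ρ : G →* (T ≃g T)} (hcoc : IsCocompactAction (isometryAction hT ρ)) :
    ∃ B : Set V, B.Finite ∧ ∀ v, ∃ g, ρ g v ∈ B := by
  obtain ⟨K, hK, hcov⟩ := hcoc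
  obtain ⟨v₀⟩ := hT.connected.nonempty
  obtain ⟨R, hR⟩ := hK.isBounded.subset_closedBall (vertex hT v₀)
  refine ⟨_, SimpleGraph.finite_setOf_dist_le hT.connected hfin v₀ ⌊R⌋₊, fun v => ?_⟩
  obtain ⟨g, y, hy, hgy⟩ := hcov (vertex hT v)
  refine ⟨g⁻¹, Nat.le_floor ?_⟩
  have h : y = vertex hT (ρ g⁻¹ v) := by
    rw [← isometryAction_vertex, ← hgy, ← IsometryEquiv.mul_apply, ← map_mul]
    simp
  have := hR hy
  rwa [h, Metric.mem_closedBall, dist_comm, dist_vertex_vertex] at this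

end TreeRealization

/-! ### Connectivity conditions for the spheres of dimension -1 and 0 -/

section SpheresExtend

variable {X : Type u} [TopologicalSpace X] {A B : Set X}

theorem SpheresExtend.nonempty (h : SpheresExtend 0 A B) : B.Nonempty := by
  have hempty : IsEmpty (Metric.sphere (0 : EuclideanSpace ℝ (Fin 0)) 1) := by
    rw [Metric.sphere_eq_empty_of_subsingleton one_ne_zero]
    exact Set.isEmpty_coe_sort.2 rfl
  obtain ⟨F, hF, -⟩ := h ⟨fun x => hempty.elim x, continuous_of_discreteTopology⟩
    fun x => hempty.elim x
  exact ⟨_, hF ⟨0, by simp⟩⟩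

/-- The two points of the 0-sphere are sent to `a` and `b`, and the image of the interval they bound
connects them. -/
theorem SpheresExtend.exists_isPreconnected (h : SpheresExtend 1 A B) {a b : X} (ha : a ∈ A)
    (hb : b ∈ A) : ∃ S ⊆ B, IsPreconnected S ∧ a ∈ S ∧ b ∈ S := by
  classical
  have hsphere : ∀ x ∈ Metric.sphere (0 : EuclideanSpace ℝ (Fin 1)) 1, x 0 ≠ 0 := by
    intro x hx h0
    rw [mem_sphere_zero_iff_norm, EuclideanSpace.norm_eq] at hx
    simp [h0] at hx
  have hcont : Continuous fun x : Metric.sphere (0 : EuclideanSpace ℝ (Fin 1)) 1 =>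
      if 0 < x.1 0 then a else b := by
    have hx : Continuous fun x : Metric.sphere (0 : EuclideanSpace ℝ (Fin 1)) 1 => x.1 0 := by
      fun_prop
    refine IsLocallyConstant.continuous ((IsLocallyConstant.iff_eventually_eq _).2 fun x => ?_)
    rcases lt_or_gt_of_ne (hsphere x.1 x.2) with h0 | h0
    · filter_upwards [hx.continuousAt.eventually_lt_const h0] with y hy
      rw [if_neg hy.not_gt, if_neg h0.not_gt]
    · filter_upwards [hx.continuousAt.eventually_const_lt h0] with y hy
      rw [if_pos hy, if_pos h0]
  obtain ⟨F, hF, hFf⟩ := h ⟨_, hcont⟩ (fun x => by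
    change (if 0 < x.1 0 then a else b) ∈ A
    split_ifs <;> assumption)
  have hpre : PreconnectedSpace (Metric.closedBall (0 : EuclideanSpace ℝ (Fin 1)) 1) :=
    isPreconnected_iff_preconnectedSpace.1 (convex_closedBall _ _).isPreconnected
  have hpos : EuclideanSpace.single (0 : Fin 1) (1 : ℝ) ∈ Metric.sphere 0 1 := by simp
  have hneg : EuclideanSpace.single (0 : Fin 1) (-1 : ℝ) ∈ Metric.sphere 0 1 := by simp
  refine ⟨Set.range F, by rintro _ ⟨x, rfl⟩; exact hF x, isPreconnected_range F.continuous,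
    ⟨_, (hFf _ hpos).trans ?_⟩, ⟨_, (hFf _ hneg).trans ?_⟩⟩
  · simp
  · simp

end SpheresExtend

/-! ### Cells and compact subsets of CW complexes -/

section CWComplex

open Topology.RelCWComplex

variable {X : Type u} [TopologicalSpace X] [Topology.CWComplex (Set.univ : Set X)]

theorem exists_mem_openCell (x : X) :
    ∃ e : Σ n, cell (Set.univ : Set X) n, x ∈ openCell e.1 e.2 := by
  have h := Topology.CWComplex.iUnion_openCell_eq_complex (C := (Set.univ : Set X))
  have hx : x ∈ ⋃ (n : ℕ) (j : cell (Set.univ : Set X) n), openCell n j := by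
    rw [h]
    exact Set.mem_univ x
  simp only [Set.mem_iUnion] at hx
  obtain ⟨n, j, hj⟩ := hx
  exact ⟨⟨n, j⟩, hj⟩

theorem cell_eq_of_mem_openCell {x : X} {e e' : Σ n, cell (Set.univ : Set X) n}
    (h : x ∈ openCell e.1 e.2) (h' : x ∈ openCell e'.1 e'.2) : e = e' := by
  by_contra hne
  exact (disjoint_openCell_of_ne hne).notMem_of_mem_left h h'

theorem finite_openCell_inter_closedCell (n : ℕ) (j : cell (Set.univ : Set X) n) :
    {e : Σ n, cell (Set.univ : Set X) n | (openCell e.1 e.2 ∩ closedCell n j).Nonempty}.Finite := by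
  obtain ⟨I, hI⟩ := Topology.CWComplex.cellFrontier_subset_finite_openCell n j
  refine ((Set.finite_singleton (⟨n, j⟩ : Σ n, cell (Set.univ : Set X) n)).union
    (Finset.finite_toSet ((Finset.range n).sigma I))).subset ?_
  rintro e ⟨x, hx, hxj⟩
  rw [← cellFrontier_union_openCell_eq_closedCell] at hxj
  rcases hxj with h | h
  · right
    have h1 := hI h
    simp only [Set.mem_iUnion] at h1
    obtain ⟨m, hm, i, hi, hxi⟩ := h1
    rw [cell_eq_of_mem_openCell (e' := ⟨m, i⟩) hx hxi]
    simpa using ⟨hm, hi⟩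
  · exact Or.inl (cell_eq_of_mem_openCell (e' := ⟨n, j⟩) hx h)

/-- A compact subset of a CW complex meets only finitely many open cells. -/
theorem IsCompact.finite_openCell [T2Space X] {K : Set X} (hK : IsCompact K) :
    {e : Σ n, cell (Set.univ : Set X) n | (openCell e.1 e.2 ∩ K).Nonempty}.Finite := by
  set S := {e : Σ n, cell (Set.univ : Set X) n | (openCell e.1 e.2 ∩ K).Nonempty} with hS
  have hex : ∀ e : S, ∃ x, x ∈ openCell e.1.1 e.1.2 ∩ K := fun e => e.2
  choose f hf using hex
  have hinj : Function.Injective f := fun e e' h => Subtype.ext <|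
    cell_eq_of_mem_openCell (hf e).1 (h ▸ (hf e').1)
  -- With one point chosen in each open cell that meets `K`, a closed cell contains only finitely
  -- many of them. So every set of chosen points is closed, and the range is discrete and compact.
  have hclosed : ∀ B ⊆ Set.range f, IsClosed B := by
    intro B hB
    refine Topology.CWComplex.closed (Set.univ : Set X) B (Set.subset_univ _) |>.2 fun n j => ?_
    refine Set.Finite.isClosed (Set.Finite.subset
      (((finite_openCell_inter_closedCell n j).preimage Subtype.val_injective.injOn).image f) ?_)
    rintro x ⟨hx, hxj⟩
    obtain ⟨e, rfl⟩ := hB hx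
    exact ⟨e, ⟨f e, (hf e).1, hxj⟩, rfl⟩
  have hcomp : IsCompact (Set.range f) :=
    hK.of_isClosed_subset (hclosed _ subset_rfl) (by rintro _ ⟨e, rfl⟩; exact (hf e).2)
  have hfin : (Set.range f).Finite := by
    refine hcomp.finite (isDiscrete_iff_forall_mem_exists_isClosed.2 fun B hB => ?_)
    exact ⟨B, hclosed B hB, Set.inter_eq_left.2 hB⟩
  have : Finite S := Set.finite_range_iff hinj |>.1 hfin
  exact Set.toFinite S

theorem disjoint_openCell_cellFrontier (n : ℕ) (e : cell (Set.univ : Set X) n) :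
    Disjoint (openCell n e) (cellFrontier n e) := by
  refine Set.disjoint_left.2 fun x hx hx' => ?_
  obtain ⟨I, hI⟩ := Topology.CWComplex.cellFrontier_subset_finite_openCell n e
  have h1 := hI hx'
  simp only [Set.mem_iUnion] at h1
  obtain ⟨m, hm, i, hi, hxi⟩ := h1
  have := cell_eq_of_mem_openCell (e := ⟨n, e⟩) (e' := ⟨m, i⟩) hx hxi
  exact hm.ne' (congrArg Sigma.fst this)

/-- The frontier is the closure of the open cell minus the open cell, so it is determined by the
open cell as a set; characteristic maps need not be respected. -/
theorem image_cellFrontier [T2Space X] (φ : X ≃ₜ X) {n : ℕ} {e e' : cell (Set.univ : Set X) n}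
    (h : φ '' openCell n e = openCell n e') : φ '' cellFrontier n e = cellFrontier n e' := by
  have key : ∀ e : cell (Set.univ : Set X) n,
      cellFrontier n e = closure (openCell n e) \ openCell n e := by
    intro e
    rw [closure_openCell_eq_closedCell, ← cellFrontier_union_openCell_eq_closedCell,
      Set.union_sdiff_right, (disjoint_openCell_cellFrontier n e).symm.sdiff_eq_left]
  rw [key, key, Set.image_sdiff φ.injective, φ.image_closure, h]

end CWComplex

/-! ### Proper discontinuity of the action on the complex -/

namespace FreeCocompactComplex

open Topology.RelCWComplex

variable {G : Type u} [Group G] (P : FreeCocompactComplex G 1)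

theorem action_inv_apply (g : G) (x : P.X) : P.action g⁻¹ (P.action g x) = x := by
  rw [← Homeomorph.mul_apply, ← map_mul]
  simp

theorem action_injective (x : P.X) : Function.Injective fun g => P.action g x := by
  intro g g' h
  have h1 : P.action (g'⁻¹ * g) x = x := by
    rw [map_mul, Homeomorph.mul_apply]
    exact (congrArg (P.action g'⁻¹) h).trans (P.action_inv_apply g' x)
  exact (inv_mul_eq_one.1 (P.free _ _ h1)).symm

/-- In a free complex of dimension at most one, only finitely many group elements move a given
cell to a point of another given cell. -/
theorem finite_image_openCell_inter (e e' : Σ n, cell (Set.univ : Set P.X) n) :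
    {g | (P.action g '' openCell e.1 e.2 ∩ openCell e'.1 e'.2).Nonempty}.Finite := by
  obtain ⟨n, e⟩ := e
  have himage : ∀ g, (P.action g '' openCell n e ∩ openCell e'.1 e'.2).Nonempty →
      ∃ e'' : cell (Set.univ : Set P.X) n, e' = ⟨n, e''⟩ ∧
        P.action g '' openCell n e = openCell n e'' := by
    rintro g ⟨x, hx, hx'⟩
    obtain ⟨e'', he''⟩ := P.permutes g n e
    rw [he''] at hx
    exact ⟨e'', (cell_eq_of_mem_openCell (e' := ⟨n, e''⟩) hx' hx), he''⟩
  have hfinite : ∀ A : Set P.X, ∀ x : P.X, A.Finite → {g | P.action g x ∈ A}.Finite :=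
    fun A x hA => hA.preimage (P.action_injective x).injOn
  by_cases hn : n = 0
  · subst hn
    obtain ⟨x, hx⟩ := openCell_nonempty 0 e
    rcases e' with ⟨m, e'⟩
    by_cases hm : m = 0
    · subst hm
      refine (hfinite (openCell 0 e') x ?_).subset fun g hg => ?_
      · rw [openCell_zero_eq_singleton]
        exact Set.finite_singleton _
      · obtain ⟨e'', h1, h2⟩ := himage g hg
        obtain rfl := eq_of_heq (Sigma.mk.inj h1).2
        exact h2 ▸ Set.mem_image_of_mem _ hx
    · refine Set.finite_empty.subset fun g hg => hm ?_
      obtain ⟨e'', h1, -⟩ := himage g hg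
      exact congrArg Sigma.fst h1
  · have hn1 : n = 1 := by
      by_contra h
      exact (P.dim_le n (by omega)).false e
    subst hn1
    -- A frontier point of the 1-cell must go to one of the finitely many frontier points of the
    -- other; freeness then leaves finitely many group elements.
    obtain ⟨x, hx⟩ := nonempty_cellFrontier one_ne_zero e
    rcases e' with ⟨m, e'⟩
    by_cases hm : m = 1
    · subst hm
      refine (hfinite (cellFrontier 1 e') x ?_).subset fun g hg => ?_
      · rw [cellFrontier_one_eq]
        exact (Set.toFinite _).image _
      · obtain ⟨e'', h1, h2⟩ := himage g hg
        obtain rfl := eq_of_heq (Sigma.mk.inj h1).2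
        exact image_cellFrontier _ h2 ▸ Set.mem_image_of_mem _ hx
    · refine Set.finite_empty.subset fun g hg => hm ?_
      obtain ⟨e'', h1, -⟩ := himage g hg
      exact congrArg Sigma.fst h1

/-- The action on the complex is properly discontinuous. -/
theorem finite_image_inter {K K' : Set P.X} (hK : IsCompact K) (hK' : IsCompact K') :
    {g | (P.action g '' K ∩ K').Nonempty}.Finite := by
  refine (hK.finite_openCell.biUnion fun e _ => hK'.finite_openCell.biUnion fun e' _ =>
    P.finite_image_openCell_inter e e').subset ?_
  rintro g ⟨_, ⟨x, hx, rfl⟩, hx'⟩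
  obtain ⟨e, he⟩ := exists_mem_openCell x
  obtain ⟨e', he'⟩ := exists_mem_openCell (P.action g x)
  exact Set.mem_biUnion (show e ∈ _ from ⟨x, he, hx⟩)
    (Set.mem_biUnion (show e' ∈ _ from ⟨_, he', hx'⟩) ⟨_, ⟨x, he, rfl⟩, he'⟩)

/-- Closedness can be tested on closed cells, and by proper discontinuity each of these meets only
finitely many translates. -/
theorem isClosed_biUnion_image {K : Set P.X} (hK : IsCompact K) (I : Set G) :
    IsClosed (⋃ g ∈ I, P.action g '' K) := by
  refine Topology.CWComplex.closed (Set.univ : Set P.X) _ (Set.subset_univ _) |>.2 fun n j => ?_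
  have hfin := P.finite_image_inter hK (isCompact_closedCell (i := j))
  have h : (⋃ g ∈ I, P.action g '' K) ∩ closedCell n j =
      (⋃ g ∈ I ∩ {g | (P.action g '' K ∩ closedCell n j).Nonempty}, P.action g '' K) ∩
        closedCell n j := by
    ext x
    simp only [Set.mem_inter_iff, Set.mem_iUnion, exists_prop, and_congr_left_iff]
    exact fun hx => ⟨fun ⟨g, hg, hxg⟩ => ⟨g, ⟨hg, ⟨x, hxg, hx⟩⟩, hxg⟩,
      fun ⟨g, hg, hxg⟩ => ⟨g, hg.1, hxg⟩⟩
  rw [h]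
  exact ((hfin.subset Set.inter_subset_right).isClosed_biUnion fun g _ =>
    (hK.image (P.action g).continuous).isClosed).inter isClosed_closedCell

theorem nonempty_cell_zero : Nonempty (cell (Set.univ : Set P.X) 0) := by
  obtain ⟨x, -⟩ := (P.connected 0 zero_le_one).nonempty
  obtain ⟨⟨n, e⟩, -⟩ := exists_mem_openCell x
  rcases Nat.eq_zero_or_pos n with rfl | hn
  · exact ⟨e⟩
  · have hn1 : n = 1 := by
      by_contra h
      exact (P.dim_le n (by omega)).false e
    subst hn1
    obtain ⟨y, -⟩ := Topology.CWComplex.exists_cellFrontier_one_eq e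
    exact ⟨y⟩

/-- There is a point all of whose translates are vertices, hence subcomplexes. -/
theorem exists_vertex : ∃ x₀ : P.X, ∀ g,
    ∃ S : Topology.RelCWComplex.Subcomplex (Set.univ : Set P.X), (S : Set P.X) = {P.action g x₀} := by
  obtain ⟨e⟩ := P.nonempty_cell_zero
  obtain ⟨x₀, hx₀⟩ := openCell_nonempty 0 e
  refine ⟨x₀, fun g => ?_⟩
  obtain ⟨e', he'⟩ := P.permutes g 0 e
  have hmem : P.action g x₀ ∈ openCell 0 e' := he' ▸ Set.mem_image_of_mem _ hx₀
  have hopen : openCell 0 e' = {P.action g x₀} := by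
    rw [openCell_zero_eq_singleton] at hmem ⊢
    rw [Set.mem_singleton_iff.1 hmem]
  have hclosed : closedCell 0 e' = {P.action g x₀} := by
    rw [closedCell_zero_eq_singleton, ← openCell_zero_eq_singleton, hopen]
  refine ⟨Topology.CWComplex.Subcomplex.mk' (Set.univ : Set P.X) {P.action g x₀}
    (fun n => {i | (⟨n, i⟩ : Σ n, cell (Set.univ : Set P.X) n) = ⟨0, e'⟩}) ?_ ?_, rfl⟩
  · rintro n ⟨i, hi⟩
    obtain ⟨rfl, h⟩ := Sigma.mk.inj hi
    obtain rfl := eq_of_heq h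
    exact hclosed.subset
  · ext x
    simp only [Set.mem_iUnion]
    constructor
    · rintro ⟨n, ⟨i, hi⟩, hx⟩
      obtain ⟨rfl, h⟩ := Sigma.mk.inj hi
      obtain rfl := eq_of_heq h
      exact hopen ▸ hx
    · exact fun hx => ⟨0, ⟨e', rfl⟩, hopen ▸ hx⟩

end FreeCocompactComplex

/-! ### Minimal actions on trees -/

section MinimalTrees

variable {G : Type u} [Group G] {W : Type w} {T' : SimpleGraph W} {ρ' : G →* (T' ≃g T')}

theorem IsMinimalAction.eq_univ (hmin : IsMinimalAction ρ') {A : Set W}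
    (hA : (T'.induce A).Connected) (hinv : ∀ g, ∀ w ∈ A, ρ' g w ∈ A) : A = Set.univ := by
  have h := hmin ((⊤ : T'.Subgraph).induce A) ?_ (fun g v hv => hinv g v hv) ?_
  · exact congrArg SimpleGraph.Subgraph.verts h
  · exact SimpleGraph.connected_induce_iff.1 hA
  · rintro g u v ⟨hu, hv, huv⟩
    exact ⟨hinv g u hu, hinv g v hv, (ρ' g).map_rel_iff.2 huv⟩

/-- If a finitely generated group acts minimally on a tree, each orbit is coarsely dense. -/
theorem IsMinimalAction.exists_dist_orbit_le [Group.FG G] (hT' : T'.Connected)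
    (hmin : IsMinimalAction ρ') (w₀ : W) : ∃ C : ℕ, ∀ w, ∃ g, T'.dist w (ρ' g w₀) ≤ C := by
  obtain ⟨S, hS⟩ := Group.FG.out (G := G)
  -- With `C` the largest displacement of `w₀` by a generator, the `C`-neighbourhood of the orbit is
  -- connected: geodesics to orbit points stay inside, and the orbit points of `g` and `g * s` are
  -- at most `C` apart. It is invariant, hence everything.
  set C : ℕ := S.sup fun s => T'.dist (ρ' s w₀) w₀
  set A : Set W := {w | ∃ g, T'.dist w (ρ' g w₀) ≤ C}
  have horbit : ∀ g, ρ' g w₀ ∈ A := fun g => ⟨g, by simp⟩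
  have near : ∀ (g : G) (w : W) (hw : T'.dist w (ρ' g w₀) ≤ C),
      (T'.induce A).Reachable ⟨w, ⟨g, hw⟩⟩ ⟨ρ' g w₀, horbit g⟩ := by
    classical
    intro g w hw
    obtain ⟨p, hp⟩ := (hT' w (ρ' g w₀)).exists_walk_length_eq_dist
    refine ⟨p.induce A fun x hx => ⟨g, ?_⟩⟩
    exact (SimpleGraph.dist_le (p.dropUntil x hx)).trans
      ((p.length_dropUntil_le_length hx).trans (hp.le.trans hw))
  have translate : ∀ h g : G,
      (T'.induce A).Reachable ⟨ρ' g w₀, horbit g⟩ ⟨ρ' (g * h) w₀, horbit (g * h)⟩ := by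
    intro h
    have hmem : h ∈ Subgroup.closure (S : Set G) := hS ▸ Subgroup.mem_top h
    induction hmem using Subgroup.closure_induction with
    | mem s hs =>
      intro g
      refine (near g _ ?_).symm
      rw [map_mul, RelIso.mul_apply, SimpleGraph.dist_iso_apply]
      exact Finset.le_sup (f := fun s => T'.dist (ρ' s w₀) w₀) hs
    | one => intro g; simp only [mul_one]; rfl
    | mul a b _ _ ha hb =>
      intro g
      have := (ha g).trans (hb (g * a))
      simpa only [mul_assoc] using this
    | inv a _ ha =>
      intro g
      have := (ha (g * a⁻¹)).symm
      simpa only [inv_mul_cancel_right] using this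
  have hconn : (T'.induce A).Connected := by
    have : Nonempty A := ⟨⟨_, horbit 1⟩⟩
    refine ⟨?_⟩
    rintro ⟨w, g, hw⟩ ⟨w', g', hw'⟩
    have := translate (g⁻¹ * g') g
    simp only [mul_inv_cancel_left] at this
    exact (near g w hw).trans (this.trans (near g' w' hw').symm)
  have huniv := hmin.eq_univ hconn (by
    rintro h w ⟨g, hg⟩
    refine ⟨h * g, ?_⟩
    rwa [map_mul, RelIso.mul_apply, SimpleGraph.dist_iso_apply])
  exact ⟨C, fun w => huniv.symm.subset (Set.mem_univ w)⟩

/-- An infinite tree with a minimal action has no leaves. -/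
theorem IsMinimalAction.exists_adj_adj_ne [Infinite W] (hT' : T'.Connected)
    (hmin : IsMinimalAction ρ') (x : W) : ∃ y z, T'.Adj x y ∧ T'.Adj x z ∧ y ≠ z := by
  by_contra! hx
  have horbit : ∀ g a b, T'.Adj (ρ' g x) a → T'.Adj (ρ' g x) b → a = b := by
    intro g a b ha hb
    have ha' := (ρ' g).symm.map_rel_iff.2 ha
    have hb' := (ρ' g).symm.map_rel_iff.2 hb
    rw [RelIso.symm_apply_apply] at ha' hb'
    exact (ρ' g).symm.injective (hx _ _ ha' hb')
  obtain ⟨x', hx'⟩ := exists_ne x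
  obtain ⟨y, hy, -⟩ := SimpleGraph.exists_adj_dist_add_one hT' hx'
  -- Removing the orbit of a leaf keeps the tree connected, since a path has no leaf in its
  -- interior; this contradicts minimality.
  set A : Set W := {w | ∀ g, w ≠ ρ' g x}
  -- If the neighbour of the leaf `x` were in its orbit, it would be a leaf too, and the tree would
  -- be a single edge.
  have hyA : y ∈ A := by
    rintro g rfl
    have hall : ∀ {a b : W} (p : T'.Walk a b), a ∈ ({x, ρ' g x} : Set W) →
        b ∈ ({x, ρ' g x} : Set W) := by
      intro a b p
      induction p with
      | nil => exact id
      | @cons a c b hac p ih =>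
        rintro (rfl | rfl)
        · exact ih (Or.inr (hx _ _ hac hy))
        · exact ih (Or.inl (horbit g _ _ hac hy.symm))
    refine Set.infinite_univ ((Set.toFinite ({x, ρ' g x} : Set W)).subset fun w _ => ?_)
    obtain ⟨p⟩ := hT' x w
    exact hall p (Or.inl rfl)
  have hpath : ∀ {a b : W} (p : T'.Walk a b), p.IsPath → ∀ (ha : a ∈ A) (hb : b ∈ A),
      (T'.induce A).Reachable ⟨a, ha⟩ ⟨b, hb⟩ := by
    intro a b p
    induction p with
    | nil => intro _ _ _; rfl
    | @cons a c b hac p ih =>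
      intro hp ha hb
      rw [SimpleGraph.Walk.cons_isPath_iff] at hp
      by_cases hc : c ∈ A
      · have hadj : (T'.induce A).Adj ⟨a, ha⟩ ⟨c, hc⟩ := hac
        exact hadj.reachable.trans (ih hp.1 hc hb)
      · exfalso
        simp only [A, Set.mem_ofPred_eq, not_forall, not_not] at hc
        obtain ⟨g, rfl⟩ := hc
        cases p with
        | nil => exact hb g rfl
        | @cons _ d _ hd p =>
          obtain rfl := horbit g _ _ hac.symm hd
          exact hp.2 (by simp)
  have hconn : (T'.induce A).Connected := by
    classical
    have : Nonempty A := ⟨⟨y, hyA⟩⟩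
    refine ⟨?_⟩
    rintro ⟨a, ha⟩ ⟨b, hb⟩
    obtain ⟨p⟩ := hT' a b
    exact hpath p.bypass p.bypass_isPath ha hb
  have huniv := hmin.eq_univ hconn (by
    intro h w hw g hg
    refine hw (h⁻¹ * g) ?_
    rw [map_mul, RelIso.mul_apply, ← hg, ← RelIso.mul_apply, ← map_mul]
    simp)
  exact (huniv.symm.subset (Set.mem_univ x)) 1 (by simp)

theorem StarSurjective.surjective {V : Type v} {T : SimpleGraph V} (hT : T.Connected) [Nonempty W]
    {q : T' →g T} (hq : StarSurjective q) : Function.Surjective q := by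
  have key : ∀ {a b : V} (p : T.Walk a b), a ∈ Set.range q → b ∈ Set.range q := by
    intro a b p
    induction p with
    | nil => exact id
    | @cons a c b hac p ih =>
      rintro ⟨x, rfl⟩
      obtain ⟨z, -, hz⟩ := hq x c hac
      exact ih ⟨z, hz⟩
  intro v
  obtain ⟨x⟩ := ‹Nonempty W›
  obtain ⟨p⟩ := hT (q x) v
  exact key p ⟨x, rfl⟩

end MinimalTrees

/-- In a graph without leaves, each edge is the first one of an infinite path without
backtracking. -/
theorem SimpleGraph.exists_ray_of_no_leaf {V : Type*} {T : SimpleGraph V}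
    (h : ∀ u v, T.Adj u v → ∃ w, T.Adj v w ∧ w ≠ u) {x y : V} (hxy : T.Adj x y) :
    ∃ c : ℕ → V, c 0 = x ∧ c 1 = y ∧ (∀ n, T.Adj (c n) (c (n + 1))) ∧ ∀ n, c (n + 2) ≠ c n := by
  choose! next hnext using h
  set d : ℕ → V × V := fun n => (fun p : V × V => (p.2, next p.1 p.2))^[n] (x, y) with hd
  have hsucc : ∀ n, d (n + 1) = ((d n).2, next (d n).1 (d n).2) := fun n => by
    simp only [hd, Function.iterate_succ_apply']
  have hadj : ∀ n, T.Adj (d n).1 (d n).2 := by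
    intro n
    induction n with
    | zero => exact hxy
    | succ n ih => rw [hsucc]; exact (hnext _ _ ih).1
  refine ⟨fun n => (d n).1, rfl, rfl, fun n => ?_, fun n => ?_⟩
  · have := hadj n
    simpa only [hsucc] using this
  · simpa only [hsucc] using (hnext _ _ (hadj n)).2

/-! ### Controlled connectedness bounds the depth of ascending folds -/

section ControlledConnectivity

open TreeRealization

variable {G : Type u} [Group G] [Group.FG G] {V : Type v} {T : SimpleGraph V} {hT : T.IsTree}
  {ρ : G →* (T ≃g T)} {W : Type w} {T' : SimpleGraph W} {ρ' : G →* (T' ≃g T')} {q : T' →g T}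

/-- If the action on `T` is controlled connected over the end of `τ`, then the vertices of `T'` at
which `q` folds two edges that ascend towards this end have bounded depth. -/
theorem ControlMap.Controlled.exists_le_busemann {P : FreeCocompactComplex G 1}
    {h : ControlMap P (isometryAction hT ρ)} {τ : GeodesicRay (TreeRealization hT)}
    (hctl : h.Controlled τ) {up : V → V}
    (hup : T.IsHorofunction (fun v => busemann τ (vertex hT v)) up)
    (hT' : T'.IsTree) (hmin : IsMinimalAction ρ')
    (hq : ∀ (g : G) (x : W), q (ρ' g x) = ρ g (q x)) (hsurj : StarSurjective q) :
    ∃ s : ℝ, ∀ x y z, T'.Adj x y → T'.Adj x z → y ≠ z → up (q x) = q y → up (q x) = q z →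
      s ≤ busemann τ (vertex hT (q x)) := by
  obtain ⟨w₀⟩ := hT'.connected.nonempty
  obtain ⟨C, hC⟩ := hmin.exists_dist_orbit_le hT'.connected w₀
  obtain ⟨x₀, hx₀⟩ := P.exists_vertex
  obtain ⟨K₀, hK₀, hcov₀⟩ := P.cocompact
  set K := insert x₀ K₀
  have hK : IsCompact K := hK₀.insert x₀
  obtain ⟨D, hD⟩ :=
    (hK.image h.toFun.continuous).isBounded.subset_closedBall (vertex hT (q w₀))
  have hdist : ∀ g, ∀ k ∈ K,
      dist (h.toFun (P.action g k)) (vertex hT (q (ρ' g w₀))) ≤ D := by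
    intro g k hk
    rw [h.equivariant, hq, ← isometryAction_vertex, IsometryEquiv.dist_eq]
    exact hD ⟨k, hk, rfl⟩
  obtain ⟨N, hN⟩ := ((P.finite_image_inter hK hK).image fun g => T'.dist w₀ (ρ' g w₀)).bddAbove
  have hqdist : ∀ a b, dist (vertex hT (q a)) (vertex hT (q b)) ≤ T'.dist a b := by
    intro a b
    rw [dist_vertex_vertex]
    exact_mod_cast SimpleGraph.Hom.dist_le hT'.connected q a b
  obtain ⟨l, -, hl⟩ := hctl 0 1 le_rfl
  -- The connection will contain a point of height at least `0 - l 0`, whose image in T is within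
  -- `D` of the image of an orbit point that lies within `N` of `x`.
  refine ⟨(0 - l 0) - D - N, fun x y z hy hz hyz hqy hqz => ?_⟩
  have hlift : ∀ a, ∃ a', T'.Adj a a' ∧ q a' = up (q a) := fun a => hsurj a _ (hup.adj_up _)
  choose L hLadj hLq using hlift
  have hLiter : ∀ n a, q (L^[n] a) = up^[n] (q a) := by
    intro n a
    induction n with
    | zero => rfl
    | succ n ih => rw [Function.iterate_succ_apply', hLq, ih, Function.iterate_succ_apply']
  have hheight : ∀ n a, up (q x) = q a → busemann τ (vertex hT (q (L^[n] a))) =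
      busemann τ (vertex hT (q x)) + 1 + n := by
    intro n a ha
    rw [hLiter, hup.apply_iterate n (q a), ← ha, hup.apply_up]
  have hLne : ∀ n a, up (q x) = q a → L^[n] a ≠ x := by
    intro n a ha hax
    have h1 := hheight n a ha
    rw [hax] at h1
    have : (0 : ℝ) ≤ n := Nat.cast_nonneg n
    linarith
  set B := T'.branch y x
  have hLB : ∀ n a, up (q x) = q a → (L^[n] a ∈ B ↔ a ∈ B) := by
    intro n a ha
    induction n with
    | zero => rfl
    | succ n ih =>
      rw [← ih, Function.iterate_succ_apply']
      refine (SimpleGraph.mem_branch_iff_of_adj (hLadj _) fun hs => ?_).symm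
      have h1 := hLne n a ha
      have h2 := hLne (n + 1) a ha
      rw [Function.iterate_succ_apply'] at h2
      rcases Sym2.eq_iff.1 hs with ⟨-, h3⟩ | ⟨h3, -⟩
      · exact h2 h3
      · exact h1 h3
  have hyB : y ∈ B := SimpleGraph.mem_branch_self y x
  have hxB : x ∉ B := hT'.isAcyclic.notMem_branch hy.symm
  have hzB : z ∉ B := by
    refine fun hzB => hxB ((SimpleGraph.mem_branch_iff_of_adj hz fun hs => ?_).2 hzB)
    rcases Sym2.eq_iff.1 hs with ⟨h3, -⟩ | ⟨-, h3⟩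
    · exact hy.ne h3
    · exact hyz h3.symm
  -- The bound by `C` makes `L^[n] a` farther from `x` than from a nearby orbit point, so both lie
  -- on one side; the other bound lifts the corresponding point of the complex over the horoball of
  -- level 0.
  obtain ⟨n, hn⟩ := exists_nat_gt (max (C : ℝ) (C + D - busemann τ (vertex hT (q x))))
  have hnC : (C : ℝ) < n := (le_max_left _ _).trans_lt hn
  have hnD := (le_max_right _ _).trans_lt hn
  -- orbit points near a lifted ascending path lie on the same side, and their images are high
  have hpoint : ∀ a, up (q x) = q a → ∃ g, (ρ' g w₀ ∈ B ↔ a ∈ B) ∧ P.action g x₀ ∈ h.over τ 0 := by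
    intro a ha
    obtain ⟨g, hg⟩ := hC (L^[n] a)
    have hg' : (T'.dist (L^[n] a) (ρ' g w₀) : ℝ) ≤ C := by exact_mod_cast hg
    refine ⟨g, ?_, ?_⟩
    · have hfar : (C : ℝ) < T'.dist (L^[n] a) x := by
        have h1 := busemann_sub_le τ (vertex hT (q x)) (vertex hT (q (L^[n] a)))
        have h2 := hqdist x (L^[n] a)
        rw [hheight n a ha] at h1
        rw [T'.dist_comm] at h2
        linarith
      rw [← hLB n a ha]
      constructor
      · intro h1
        by_contra h2
        have h3 := hT'.dist_eq_of_branch hy.symm h1 h2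
        rw [T'.dist_comm] at h3
        have h4 : T'.dist (L^[n] a) x ≤ T'.dist (L^[n] a) (ρ' g w₀) := by
          rw [h3, T'.dist_comm]
          omega
        have h5 : (T'.dist (L^[n] a) x : ℝ) ≤ T'.dist (L^[n] a) (ρ' g w₀) := by exact_mod_cast h4
        linarith
      · intro h1
        by_contra h2
        have h3 := hT'.dist_eq_of_branch hy.symm h1 h2
        have h4 := hT'.dist_of_mem_branch hy.symm h1
        have h5 : T'.dist (L^[n] a) x ≤ T'.dist (L^[n] a) (ρ' g w₀) := by omega
        have h6 : (T'.dist (L^[n] a) x : ℝ) ≤ T'.dist (L^[n] a) (ρ' g w₀) := by exact_mod_cast h5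
        linarith
    · obtain ⟨S, hS⟩ := hx₀ g
      refine Set.mem_iUnion.2 ⟨⟨S, ?_⟩, ?_⟩
      · rw [hS, Set.singleton_subset_iff]
        change 0 ≤ busemann τ (h.toFun (P.action g x₀))
        have h1 := busemann_sub_le τ (h.toFun (P.action g x₀)) (vertex hT (q (L^[n] a)))
        have h2 := dist_triangle (h.toFun (P.action g x₀)) (vertex hT (q (ρ' g w₀)))
          (vertex hT (q (L^[n] a)))
        have h3 := hdist g x₀ (Set.mem_insert _ _)
        have h4 := hqdist (L^[n] a) (ρ' g w₀)
        rw [dist_comm] at h4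
        rw [hheight n a ha] at h1
        linarith
      · change P.action g x₀ ∈ (S : Set P.X)
        rw [hS]
        rfl
  obtain ⟨g₁, hg₁, ha₁⟩ := hpoint y hqy
  obtain ⟨g₂, hg₂, ha₂⟩ := hpoint z hqz
  obtain ⟨S, hS, hSconn, h₁S, h₂S⟩ := hl.exists_isPreconnected ha₁ ha₂
  -- The translates of `K` cover the complex. Sorted by the side of `x` on which their orbit points
  -- lie, they form two closed sets that both meet `S`, so some point of `S` is in both.
  obtain ⟨p, hpS, hp₁, hp₂⟩ := isPreconnected_closed_iff.1 hSconn _ _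
    (P.isClosed_biUnion_image hK {g | ρ' g w₀ ∈ B}) (P.isClosed_biUnion_image hK {g | ρ' g w₀ ∉ B})
    (fun p _ => by
      obtain ⟨g, k, hk, hgk⟩ := hcov₀ p
      have hp : p ∈ P.action g '' K := ⟨k, Set.mem_insert_of_mem _ hk, hgk⟩
      by_cases hg : ρ' g w₀ ∈ B
      · exact Or.inl (Set.mem_biUnion (x := g) hg hp)
      · exact Or.inr (Set.mem_biUnion (x := g) hg hp))
    ⟨_, h₁S, Set.mem_biUnion (x := g₁) (hg₁.2 hyB) ⟨x₀, Set.mem_insert _ _, rfl⟩⟩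
    ⟨_, h₂S, Set.mem_biUnion (x := g₂) (fun hg => hzB (hg₂.1 hg)) ⟨x₀, Set.mem_insert _ _, rfl⟩⟩
  simp only [Set.mem_iUnion, exists_prop] at hp₁ hp₂
  obtain ⟨g, hgB, k, hk, rfl⟩ := hp₁
  obtain ⟨g', hgB', k', hk', hkk'⟩ := hp₂
  have hgg' : T'.dist (ρ' g w₀) (ρ' g' w₀) ≤ N := by
    have h1 : T'.dist w₀ (ρ' (g⁻¹ * g') w₀) ≤ N := by
      refine hN ⟨g⁻¹ * g', ⟨k, ⟨k', hk', ?_⟩, hk⟩, rfl⟩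
      rw [map_mul, Homeomorph.mul_apply, hkk', P.action_inv_apply]
    rwa [← SimpleGraph.dist_iso_apply (ρ' g), ← RelIso.mul_apply, ← map_mul,
      mul_inv_cancel_left] at h1
  -- The two orbit points are at most `N` apart, and the geodesic between them crosses the edge from
  -- `y` to `x`.
  have hgx : (T'.dist (ρ' g w₀) x : ℝ) ≤ N := by
    have h1 := hT'.dist_eq_of_branch hy.symm hgB hgB'
    have h2 := hT'.dist_of_mem_branch hy.symm hgB
    exact_mod_cast (by omega : T'.dist (ρ' g w₀) x ≤ N)
  have hlow : 0 - l 0 ≤ busemann τ (h.toFun (P.action g k)) := by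
    obtain ⟨⟨Y, hY⟩, hpY⟩ := Set.mem_iUnion.1 (hS hpS)
    exact hY hpY
  have h1 := busemann_sub_le τ (vertex hT (q x)) (h.toFun (P.action g k))
  have h2 := dist_triangle (vertex hT (q x)) (vertex hT (q (ρ' g w₀))) (h.toFun (P.action g k))
  have h3 := hdist g k hk
  have h4 := hqdist (ρ' g w₀) x
  rw [dist_comm] at h3 h4
  linarith

end ControlledConnectivity

/-! ### Periodic translates of a folded ray -/

theorem theorem1p1 {G : Type u} [Group G] [Group.FG G]
    {V : Type v} (T : SimpleGraph V) (ρ : G →* (T ≃g T)) (hT : IsGTree ρ)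
    (hfin : ∀ v : V, (T.neighborSet v).Finite)
    (hcoc : IsCocompactAction (TreeRealization.isometryAction hT.isTree ρ))
    {W : Type w} (T' : SimpleGraph W) (ρ' : G →* (T' ≃g T')) (hT' : IsGTree ρ')
    (hmin : IsMinimalAction ρ')
    (q : T' →g T) (hq : ∀ (g : G) (x : W), q (ρ' g x) = ρ g (q x))
    (hsurj : StarSurjective q) (hninj : ¬ StarInjective q) :
    (bieriGeoghegan 1 (TreeRealization.isometryAction hT.isTree ρ)).Subsingleton := by
  rintro _ ⟨P₁, h₁, τ₁, rfl, hctl₁⟩ _ ⟨P₂, h₂, τ₂, rfl, hctl₂⟩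
  obtain ⟨up₁, hup₁⟩ := TreeRealization.exists_isHorofunction hfin τ₁
  obtain ⟨up₂, hup₂⟩ := TreeRealization.exists_isHorofunction hfin τ₂
  obtain ⟨s₁, hs₁⟩ := hctl₁.exists_le_busemann hup₁ hT'.isTree hmin hq hsurj
  obtain ⟨s₂, hs₂⟩ := hctl₂.exists_le_busemann hup₂ hT'.isTree hmin hq hsurj
  have : Infinite W := hT'.infinite
  obtain ⟨x, y, z, hy, hz, hyz, hqyz, c, hc0, hc1, hadj, hc⟩ : ∃ x y z, T'.Adj x y ∧ T'.Adj x z ∧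
      y ≠ z ∧ q y = q z ∧ ∃ c : ℕ → V, c 0 = q x ∧ c 1 = q y ∧
        (∀ n, T.Adj (c n) (c (n + 1))) ∧ ∀ n, c (n + 2) ≠ c n := by
    by_cases hleaf : ∀ u v, T.Adj u v → ∃ w, T.Adj v w ∧ w ≠ u
    · simp only [StarInjective, not_forall] at hninj
      obtain ⟨x, y, z, hy, hz, hqyz, hyz⟩ := hninj
      exact ⟨x, y, z, hy, hz, hyz, hqyz, SimpleGraph.exists_ray_of_no_leaf hleaf (q.map_rel hy)⟩
    -- If T has a leaf, the ray from a given fold might be stuck. But over a leaf all edges at `x`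
    -- fold together, and there are at least two as T̃ has no leaves; the ascending path from the
    -- leaf then serves as `c`.
    · push Not at hleaf
      obtain ⟨u, v, huv, hv⟩ := hleaf
      obtain ⟨x, rfl⟩ := hsurj.surjective hT.isTree.connected v
      obtain ⟨y, z, hy, hz, hyz⟩ := hmin.exists_adj_adj_ne hT'.isTree.connected x
      have hqy := hv _ (q.map_rel hy)
      have hqz := hv _ (q.map_rel hz)
      refine ⟨x, y, z, hy, hz, hyz, hqy.trans hqz.symm, fun n => up₁^[n] (q x), rfl, ?_,
        fun n => ?_, fun n hn => ?_⟩
      · exact (hv _ (hup₁.adj_up _)).trans hqy.symm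
      · simp only [Function.iterate_succ_apply']
        exact hup₁.adj_up _
      · have h1 := hup₁.apply_iterate (n + 2) (q x)
        have h2 := hup₁.apply_iterate n (q x)
        simp only [hn] at h1
        push_cast at h1
        linarith
  obtain ⟨B, hB, hcov⟩ := TreeRealization.exists_finite_vertices hfin hcoc
  choose γ hγ using fun n => hcov (c n)
  -- Up to G there are finitely many oriented edges, so two along `c` are equivalent.
  have hdarts : (⋃ a ∈ B, (Prod.mk a) '' T.neighborSet a).Finite :=
    hB.biUnion fun a _ => (hfin a).image _
  obtain ⟨i, j, hij, heq⟩ := hdarts.exists_lt_map_eq_of_forall_mem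
    (f := fun n => (ρ (γ n) (c n), ρ (γ n) (c (n + 1))))
    fun n => Set.mem_biUnion (hγ n) (Set.mem_image_of_mem _ ((ρ (γ n)).map_rel_iff.2 (hadj n)))
  obtain ⟨heq0, heq1⟩ := Prod.mk.inj heq
  have hshift : ∀ a b, ρ (γ i) a = ρ (γ j) b → ρ ((γ i)⁻¹ * γ j) b = a := by
    intro a b hab
    rw [map_mul, RelIso.mul_apply, ← hab, ← RelIso.mul_apply, ← map_mul]
    simp
  set g := (γ i)⁻¹ * γ j
  have ascend : ∀ {b : V → ℝ} {up : V → V} {s : ℝ}, T.IsHorofunction b up →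
      (∀ x y z, T'.Adj x y → T'.Adj x z → y ≠ z → up (q x) = q y → up (q x) = q z → s ≤ b (q x)) →
      ∀ k, up^[k * (j - i)] (c i) = ρ (g ^ k) (c i) := by
    intro b up s hup hs k
    have := hup.iterate_up_eq (c := fun k n => ρ (g ^ k) (c n))
      (fun k n => (ρ (g ^ k)).map_rel_iff.2 (hadj n))
      (fun k n h => hc n ((ρ (g ^ k)).injective h)) hij
      (fun k => by simp only [pow_succ, map_mul ρ, RelIso.mul_apply]; rw [hshift _ _ heq0])
      (fun k => by simp only [pow_succ, map_mul ρ, RelIso.mul_apply]; rw [hshift _ _ heq1])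
      -- By equivariance the first edge of the translated ray is the image of the translated fold,
      -- so the depth bound applies to it.
      (s := s) (fun k h => by
        simp only [hc0, hc1, ← hq] at h ⊢
        refine hs _ (ρ' (g ^ k) y) (ρ' (g ^ k) z) ((ρ' (g ^ k)).map_rel_iff.2 hy)
          ((ρ' (g ^ k)).map_rel_iff.2 hz) (fun h' => hyz ((ρ' (g ^ k)).injective h')) h ?_
        rw [h, hq, hq, hqyz]) k
    simpa using this
  refine Quotient.sound (TreeRealization.asymptotic_of_iterate_eq hup₁ hup₂ (x := c i)
    (Nat.sub_pos_of_lt hij) fun k => ?_)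
  rw [ascend hup₁ hs₁, ascend hup₂ hs₂]
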